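/- Let $M$ be a connected, Hausdorff, paracompact smooth manifold of dimension $m+1$, and let $\mathscr L\colon TM\setminus 0\to\mathbb R$ be smooth, positively homogeneous of degree two in the velocities, with vertical Hessian $g_v=\partial^2\mathscr L/\partial v^\mu\partial v^\nu$ of signature $(-,+,\dots,+)$ for every $v\neq 0$. Select a connected component of $\{v \in TM\setminus 0: \mathscr L(v)<0\}$; the nonzero vectors in its boundary are called future-directed lightlike. Let $G^\alpha$ be the spray of $\mathscr L$, $$2G^\alpha=g^{\alpha\delta}\Big(\frac{\partial^2\mathscr L}{\partial x^\gamma\partial v^\delta}v^\gamma-\frac{\partial\mathscr L}{\partial x^\delta}\Big),$$ $N^\mu_\alpha=\partial G^\mu/\partial v^\alpha$ the non-linear connection, $\frac{\delta}{\delta x^\alpha}=\frac{\partial}{\partial x^\alpha}-N^\nu_\alpha\frac{\partial}{\partial v^\nu}$, $R^\mu{}_{\alpha\beta}=\frac{\delta N^\mu_\beta}{\delta x^\alpha}-\frac{\delta N^\mu_\alpha}{\delta x^\beta}$ its curvature, $(Ric_v)_\alpha=R^\mu{}_{\mu\alpha}(x,v)$ the Ricci 1-form, $Ric(v)=Ric_v(v)$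 the Ricci scalar, and $\chi_\alpha=\big(\frac{\partial}{\partial v^\gamma}R^\gamma{}_{\alpha\nu}\big)v^\nu$. The null convergence condition is: $Ric(v)\ge 0$ for every future-directed lightlike $v$. Let $H$ be an immersed $C^1$ null hypersurface of $M$ with future-directed lightlike tangent field $n$, that is, $n(p)\in T_pH$ is future-directed lightlike and $\ker g_{n}(n,\cdot)=T_pH$ for every $p\in H$. 1. The equation $\frac{\partial}{\partial v^\alpha}Ric(v)=2(Ric_v)_\alpha$ on $TM\setminus0$ is equivalent to $\chi_\alpha=0$ on $TM\setminus 0$. 2. Suppose that the null convergence condition holds, that $\frac{\partial}{\partial v^\alpha}Ric(v)=2(Ric_v)_\alpha$ on $TM\setminus 0$, and that $Ric(n)=0$ on $H$. Then $Ric_n|_{TH}=0$. 3. Suppose that $H$ is $C^2$, $n$ is $C^1$, and $H$ is totally geodesic, that is, there is a 1-form $\omega$ on $H$ with $D_Xn=\omega(X)n$ for all $X\in TH$, where $(D_Xn)^\alpha=X(n^\alpha)+N^\alpha_\mu(x,n)X^\mu$. Then $Ric(n)=0$ on $H$. If moreover $\omega$ is $C^1$, then $Ric_n|_{TH}=0$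 is equivalent to $i_n\,d\omega=0$; in particular, $i_n\,d\omega=0$ holds if the null convergence condition and $\frac{\partial}{\partial v^\alpha}Ric(v)=2(Ric_v)_\alpha$ hold. -/

import Mathlib

open scoped Manifold ContDiff

noncomputable section

/-! ### Local Finsler geometry in coordinates

`ℓ : E × E → ℝ` is the coordinate expression `ℓ (x, v)` of a Lagrangian; all the objects below are
given by the usual coordinate formulas at a point `z = (x, v)`. -/

namespace LocalFinsler

variable {d : ℕ}

/-- The coordinate vector `∂_i` of `ℝ^d`. -/
def basisVec (i : Fin d) : EuclideanSpace ℝ (Fin d) := EuclideanSpace.single i 1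

/-- `∂f/∂x` at `z = (x, v)` in the direction `X`. -/
def dx {V : Type*} [NormedAddCommGroup V] [NormedSpace ℝ V]
    (f : EuclideanSpace ℝ (Fin d) × EuclideanSpace ℝ (Fin d) → V)
    (z : EuclideanSpace ℝ (Fin d) × EuclideanSpace ℝ (Fin d))
    (X : EuclideanSpace ℝ (Fin d)) : V :=
  fderiv ℝ f z (X, 0)

/-- `∂f/∂v` at `z = (x, v)` in the direction `X`. -/
def dv {V : Type*} [NormedAddCommGroup V] [NormedSpace ℝ V]
    (f : EuclideanSpace ℝ (Fin d) × EuclideanSpace ℝ (Fin d) → V)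
    (z : EuclideanSpace ℝ (Fin d) × EuclideanSpace ℝ (Fin d))
    (X : EuclideanSpace ℝ (Fin d)) : V :=
  fderiv ℝ f z (0, X)

/-- The matrix `g_{ij}(x, v) = ∂²ℓ / ∂v^i ∂v^j`. -/
def metricMatrix (ℓ : EuclideanSpace ℝ (Fin d) × EuclideanSpace ℝ (Fin d) → ℝ)
    (z : EuclideanSpace ℝ (Fin d) × EuclideanSpace ℝ (Fin d)) : Matrix (Fin d) (Fin d) ℝ :=
  Matrix.of fun i j => dv (fun y => dv ℓ y (basisVec j)) z (basisVec i)

/-- The spray coefficients: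
`2 G^a = ∑_c g^{ac} (∂²ℓ/∂x^b ∂v^c v^b - ∂ℓ/∂x^c)`. -/
def spray (ℓ : EuclideanSpace ℝ (Fin d) × EuclideanSpace ℝ (Fin d) → ℝ)
    (z : EuclideanSpace ℝ (Fin d) × EuclideanSpace ℝ (Fin d)) : EuclideanSpace ℝ (Fin d) :=
  WithLp.toLp 2 fun a => (1 / 2 : ℝ) * ∑ c, (metricMatrix ℓ z)⁻¹ a c *
    (dx (fun y => dv ℓ y (basisVec c)) z z.2 - dx ℓ z (basisVec c))

/-- The non-linear connection `N^a_b = ∂G^a/∂v^b`, as `X ↦ N^a_b X^b`. -/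
def nonlinConn (ℓ : EuclideanSpace ℝ (Fin d) × EuclideanSpace ℝ (Fin d) → ℝ)
    (z : EuclideanSpace ℝ (Fin d) × EuclideanSpace ℝ (Fin d)) (X : EuclideanSpace ℝ (Fin d)) :
    EuclideanSpace ℝ (Fin d) :=
  dv (spray ℓ) z X

/-- The horizontal derivative `X^b δf/δx^b`, where `δ/δx^b = ∂/∂x^b - N^a_b ∂/∂v^a`. -/
def horizDeriv (ℓ : EuclideanSpace ℝ (Fin d) × EuclideanSpace ℝ (Fin d) → ℝ)
    (f : EuclideanSpace ℝ (Fin d) × EuclideanSpace ℝ (Fin d) → EuclideanSpace ℝ (Fin d))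
    (z : EuclideanSpace ℝ (Fin d) × EuclideanSpace ℝ (Fin d)) (X : EuclideanSpace ℝ (Fin d)) :
    EuclideanSpace ℝ (Fin d) :=
  dx f z X - dv f z (nonlinConn ℓ z X)

/-- The curvature of the non-linear connection,
`R^c_{ab} = δN^c_b/δx^a - δN^c_a/δx^b`, as `(X, Y) ↦ R^c_{ab} X^a Y^b`. -/
def curvature (ℓ : EuclideanSpace ℝ (Fin d) × EuclideanSpace ℝ (Fin d) → ℝ)
    (z : EuclideanSpace ℝ (Fin d) × EuclideanSpace ℝ (Fin d)) (X Y : EuclideanSpace ℝ (Fin d)) :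
    EuclideanSpace ℝ (Fin d) :=
  horizDeriv ℓ (fun y => nonlinConn ℓ y Y) z X - horizDeriv ℓ (fun y => nonlinConn ℓ y X) z Y

/-- The Ricci 1-form `Ric_v(Y) = Tr (X ↦ R_v(X, Y))`, in components `R^c_{ca} Y^a`. -/
def ricciForm (ℓ : EuclideanSpace ℝ (Fin d) × EuclideanSpace ℝ (Fin d) → ℝ)
    (z : EuclideanSpace ℝ (Fin d) × EuclideanSpace ℝ (Fin d)) (Y : EuclideanSpace ℝ (Fin d)) : ℝ :=
  ∑ c, curvature ℓ z (basisVec c) Y c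

/-- The Ricci scalar `Ric(v) = Ric_v(v)`. -/
def ricciScalar (ℓ : EuclideanSpace ℝ (Fin d) × EuclideanSpace ℝ (Fin d) → ℝ)
    (z : EuclideanSpace ℝ (Fin d) × EuclideanSpace ℝ (Fin d)) : ℝ :=
  ricciForm ℓ z z.2

/-- `χ_a = (∂R^c_{ab}/∂v^c) v^b`, as `Y ↦ χ_a Y^a`; the last slot `z.2` is held fixed under the
derivative. -/
def chi (ℓ : EuclideanSpace ℝ (Fin d) × EuclideanSpace ℝ (Fin d) → ℝ)
    (z : EuclideanSpace ℝ (Fin d) × EuclideanSpace ℝ (Fin d)) (Y : EuclideanSpace ℝ (Fin d)) : ℝ :=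
  ∑ c, dv (fun y => curvature ℓ y Y z.2) z (basisVec c) c

end LocalFinsler

/-! ### Finsler spacetimes -/

/-- The vertical Hessian `g_v(X, Y)` at `v ∈ T_pM` of a function on the tangent bundle: the second
derivative at `v`, in directions `X` and `Y`, of its restriction to the vector space `T_pM`. -/
def verticalHessian {m : ℕ} {M : Type*} [TopologicalSpace M]
    [ChartedSpace (EuclideanSpace ℝ (Fin (m + 1))) M]
    (L : TangentBundle (𝓡 (m + 1)) M → ℝ) (v : TangentBundle (𝓡 (m + 1)) M)
    (X Y : EuclideanSpace ℝ (Fin (m + 1))) : ℝ :=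
  fderiv ℝ (fun u : EuclideanSpace ℝ (Fin (m + 1)) =>
    fderiv ℝ (fun w : EuclideanSpace ℝ (Fin (m + 1)) => L ⟨v.proj, w⟩) u Y) v.2 X

/-- A Finsler spacetime of dimension `m + 1`: a smooth Lagrangian on the slit tangent bundle
(its values on the zero section are irrelevant), positively homogeneous of degree two, with
vertical Hessian of signature `(-, +, …, +)`, together with the choice of a connected component of
the locus `L < 0`. -/
structure FinslerSpacetime (m : ℕ) (M : Type*) [TopologicalSpace M]
    [ChartedSpace (EuclideanSpace ℝ (Fin (m + 1))) M] [IsManifold (𝓡 (m + 1)) ∞ M] where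
  /-- the Finsler Lagrangian -/
  L : TangentBundle (𝓡 (m + 1)) M → ℝ
  smooth : ContMDiffOn (𝓡 (m + 1)).tangent 𝓘(ℝ, ℝ) ∞ L {v | v.2 ≠ 0}
  homogeneous : ∀ (p : M) (v : TangentSpace (𝓡 (m + 1)) p) (s : ℝ), v ≠ 0 → 0 < s →
    L ⟨p, s • v⟩ = s ^ 2 * L ⟨p, v⟩
  lorentzian : ∀ v : TangentBundle (𝓡 (m + 1)) M, v.2 ≠ 0 →
    ∃ b : Module.Basis (Fin (m + 1)) ℝ (EuclideanSpace ℝ (Fin (m + 1))), ∀ i j,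
      verticalHessian L v (b i) (b j) = if i = j then (if i = 0 then -1 else 1) else 0
  /-- the future timelike cone -/
  futureTimelike : Set (TangentBundle (𝓡 (m + 1)) M)
  isComponent : ∃ v₀ : TangentBundle (𝓡 (m + 1)) M, (v₀.2 ≠ 0 ∧ L v₀ < 0) ∧
    futureTimelike = connectedComponentIn {v | v.2 ≠ 0 ∧ L v < 0} v₀

namespace FinslerSpacetime

section

variable {m : ℕ} {M : Type*} [TopologicalSpace M]
  [ChartedSpace (EuclideanSpace ℝ (Fin (m + 1))) M] [IsManifold (𝓡 (m + 1)) ∞ M]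

/-- The future light cone: the boundary of the future timelike cone in the slit tangent bundle. -/
def futureLightCone (F : FinslerSpacetime m M) : Set (TangentBundle (𝓡 (m + 1)) M) :=
  {v | v.2 ≠ 0 ∧ v ∈ frontier F.futureTimelike}

/-- The Lagrangian in the chart of `TM` induced by a chart `e` of `M`. -/
def lagrangianIn (F : FinslerSpacetime m M)
    (e : OpenPartialHomeomorph M (EuclideanSpace ℝ (Fin (m + 1))))
    (z : EuclideanSpace ℝ (Fin (m + 1)) × EuclideanSpace ℝ (Fin (m + 1))) : ℝ :=
  F.L ⟨e.symm z.1, mfderiv (𝓡 (m + 1)) (𝓡 (m + 1)) e.symm z.1 z.2⟩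

/-- The components in the chart `e` of a vector `v ∈ T_pM`, with `p` in the domain of `e`. -/
def components (e : OpenPartialHomeomorph M (EuclideanSpace ℝ (Fin (m + 1))))
    (v : TangentBundle (𝓡 (m + 1)) M) : EuclideanSpace ℝ (Fin (m + 1)) :=
  mfderiv (𝓡 (m + 1)) (𝓡 (m + 1)) e v.proj v.2

/-- The coordinates `(x, v)` on `TM` induced by a chart `e` of `M`. -/
def coords (e : OpenPartialHomeomorph M (EuclideanSpace ℝ (Fin (m + 1))))
    (v : TangentBundle (𝓡 (m + 1)) M) :
    EuclideanSpace ℝ (Fin (m + 1)) × EuclideanSpace ℝ (Fin (m + 1)) :=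
  (e v.proj, components e v)

/-! The Ricci 1-form, the Ricci scalar and `χ` are tensorial, so the conditions below, which are
written in components, hold in all charts around a point as soon as they hold in one. They are
stated in all smooth charts. -/

/-- Null convergence condition: `Ric(v) ≥ 0` for every future-directed lightlike `v`. -/
def NullConvergence (F : FinslerSpacetime m M) : Prop :=
  ∀ e ∈ IsManifold.maximalAtlas (𝓡 (m + 1)) ∞ M, ∀ v ∈ F.futureLightCone, v.proj ∈ e.source →
    0 ≤ LocalFinsler.ricciScalar (F.lagrangianIn e) (coords e v)

/-- The equation `∂Ric(v)/∂v^a = 2 (Ric_v)_a` on the slit tangent bundle. -/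
def RicciGradientEq (F : FinslerSpacetime m M) : Prop :=
  ∀ e ∈ IsManifold.maximalAtlas (𝓡 (m + 1)) ∞ M, ∀ v : TangentBundle (𝓡 (m + 1)) M,
    v.2 ≠ 0 → v.proj ∈ e.source → ∀ a : Fin (m + 1),
      LocalFinsler.dv (LocalFinsler.ricciScalar (F.lagrangianIn e)) (coords e v)
          (LocalFinsler.basisVec a) =
        2 * LocalFinsler.ricciForm (F.lagrangianIn e) (coords e v) (LocalFinsler.basisVec a)

/-- The equation `χ_a = 0` on the slit tangent bundle. -/
def ChiVanishes (F : FinslerSpacetime m M) : Prop :=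
  ∀ e ∈ IsManifold.maximalAtlas (𝓡 (m + 1)) ∞ M, ∀ v : TangentBundle (𝓡 (m + 1)) M,
    v.2 ≠ 0 → v.proj ∈ e.source → ∀ a : Fin (m + 1),
      LocalFinsler.chi (F.lagrangianIn e) (coords e v) (LocalFinsler.basisVec a) = 0

end

section

variable {m : ℕ} {M : Type*} [TopologicalSpace M]
  [ChartedSpace (EuclideanSpace ℝ (Fin (m + 1))) M]
  {H : Type*} [TopologicalSpace H] [ChartedSpace (EuclideanSpace ℝ (Fin m)) H]

/-- The image in `TM` of a tangent vector `X ∈ T_pH` of a hypersurface `ι : H → M`. -/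
def push (ι : H → M) (p : H) (X : TangentSpace (𝓡 m) p) : TangentBundle (𝓡 (m + 1)) M :=
  ⟨ι p, mfderiv (𝓡 m) (𝓡 (m + 1)) ι p X⟩

variable [IsManifold (𝓡 (m + 1)) ∞ M]

/-- `ι : H → M` is an (immersed) `C¹` null hypersurface and `n` is a field of tangent
future-directed lightlike vectors with `ker g_n(n, ·) = T_pH` at every point. -/
structure IsNullHypersurface (F : FinslerSpacetime m M) (ι : H → M)
    (n : ∀ p : H, TangentSpace (𝓡 m) p) : Prop where
  contMDiff : ContMDiff (𝓡 m) (𝓡 (m + 1)) 1 ι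
  immersion : ∀ p, Function.Injective (mfderiv (𝓡 m) (𝓡 (m + 1)) ι p)
  lightlike : ∀ p, push ι p (n p) ∈ F.futureLightCone
  ker_eq : ∀ (p : H) (Y : TangentSpace (𝓡 (m + 1)) (ι p)),
    verticalHessian F.L (push ι p (n p)) (mfderiv (𝓡 m) (𝓡 (m + 1)) ι p (n p)) Y = 0 ↔
      Y ∈ Set.range (mfderiv (𝓡 m) (𝓡 (m + 1)) ι p)

/-- `Ric(n) = 0` on `H`. -/
def RicciScalarVanishes (F : FinslerSpacetime m M) (ι : H → M)
    (n : ∀ p : H, TangentSpace (𝓡 m) p) : Prop :=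
  ∀ e ∈ IsManifold.maximalAtlas (𝓡 (m + 1)) ∞ M, ∀ p : H, ι p ∈ e.source →
    LocalFinsler.ricciScalar (F.lagrangianIn e) (coords e (push ι p (n p))) = 0

/-- `Ric_n|_{TH} = 0`. -/
def RicciFormVanishes (F : FinslerSpacetime m M) (ι : H → M)
    (n : ∀ p : H, TangentSpace (𝓡 m) p) : Prop :=
  ∀ e ∈ IsManifold.maximalAtlas (𝓡 (m + 1)) ∞ M, ∀ p : H, ι p ∈ e.source →
    ∀ Y : TangentSpace (𝓡 m) p,
      LocalFinsler.ricciForm (F.lagrangianIn e) (coords e (push ι p (n p)))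
        (components e (push ι p Y)) = 0

/-- The covariant derivative `D_X n` for `X ∈ T_pH`, in components in the chart `e`:
`X(n^a) + N^a_b(ι p, n) X^b`. -/
def covDerivIn (F : FinslerSpacetime m M)
    (e : OpenPartialHomeomorph M (EuclideanSpace ℝ (Fin (m + 1)))) (ι : H → M)
    (n : ∀ p : H, TangentSpace (𝓡 m) p) (p : H) (X : TangentSpace (𝓡 m) p) :
    EuclideanSpace ℝ (Fin (m + 1)) :=
  (show EuclideanSpace ℝ (Fin (m + 1)) from
    mfderiv (𝓡 m) (𝓡 (m + 1)) (fun q => components e (push ι q (n q))) p X) +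
  LocalFinsler.nonlinConn (F.lagrangianIn e) (coords e (push ι p (n p)))
    (components e (push ι p X))

/-- The null hypersurface `H` is of class `C²`, `n` is of class `C¹`, and `H` is totally geodesic,
with `D_X n = η(X) n` for all `X ∈ TH`. The equation is vectorial, hence independent of the
chart. -/
structure IsTotallyGeodesic [IsManifold (𝓡 m) 1 H] (F : FinslerSpacetime m M) (ι : H → M)
    (n : ∀ p : H, TangentSpace (𝓡 m) p)
    (η : ∀ p : H, TangentSpace (𝓡 m) p →L[ℝ] ℝ) : Prop where
  isManifold : IsManifold (𝓡 m) 2 H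
  contMDiff : ContMDiff (𝓡 m) (𝓡 (m + 1)) 2 ι
  contMDiff_field : ContMDiff (𝓡 m) (𝓡 m).tangent 1
    (fun p => (⟨p, n p⟩ : TangentBundle (𝓡 m) H))
  covDeriv_eq : ∀ e ∈ IsManifold.maximalAtlas (𝓡 (m + 1)) ∞ M, ∀ p : H, ι p ∈ e.source →
    ∀ X : TangentSpace (𝓡 m) p,
      F.covDerivIn e ι n p X = η p X • components e (push ι p (n p))

end

end FinslerSpacetime

/-! ### 1-forms on the hypersurface -/

section

variable {m : ℕ} {H : Type*} [TopologicalSpace H] [ChartedSpace (EuclideanSpace ℝ (Fin m)) H]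

/-- The expression of a 1-form in a chart `h` of `H`. -/
def oneFormIn (h : OpenPartialHomeomorph H (EuclideanSpace ℝ (Fin m)))
    (η : ∀ p : H, TangentSpace (𝓡 m) p →L[ℝ] ℝ) (y : EuclideanSpace ℝ (Fin m)) :
    EuclideanSpace ℝ (Fin m) →L[ℝ] ℝ :=
  (η (h.symm y)).comp (mfderiv (𝓡 m) (𝓡 m) h.symm y)

/-- The 1-form `η` on the `C²` manifold `H` is of class `C¹`. -/
def IsC1OneForm (η : ∀ p : H, TangentSpace (𝓡 m) p →L[ℝ] ℝ) : Prop :=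
  ∀ h ∈ IsManifold.maximalAtlas (𝓡 m) 2 H, ContDiffOn ℝ 1 (oneFormIn h η) h.target

/-- `dη(X, Y)` for `X, Y ∈ T_pH`, computed in the chart `h`:
`(∂_i η_j - ∂_j η_i) X^i Y^j`. -/
def extDerivIn (h : OpenPartialHomeomorph H (EuclideanSpace ℝ (Fin m)))
    (η : ∀ p : H, TangentSpace (𝓡 m) p →L[ℝ] ℝ) (p : H) (X Y : TangentSpace (𝓡 m) p) : ℝ :=
  let X' : EuclideanSpace ℝ (Fin m) := mfderiv (𝓡 m) (𝓡 m) h p X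
  let Y' : EuclideanSpace ℝ (Fin m) := mfderiv (𝓡 m) (𝓡 m) h p Y
  fderiv ℝ (oneFormIn h η) (h p) X' Y' - fderiv ℝ (oneFormIn h η) (h p) Y' X'

/-- `i_n dη = 0` on `H`. -/
def InteriorExtDerivVanishes (n : ∀ p : H, TangentSpace (𝓡 m) p)
    (η : ∀ p : H, TangentSpace (𝓡 m) p →L[ℝ] ℝ) : Prop :=
  ∀ h ∈ IsManifold.maximalAtlas (𝓡 m) 2 H, ∀ p ∈ h.source, ∀ Y : TangentSpace (𝓡 m) p,
    extDerivIn h η p (n p) Y = 0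

end

end

/-! Two facts about the curvature drive everything. The vertical derivatives of R satisfy a cyclic
(Bianchi) identity, because they are expressions in derivatives of the spray, which are symmetric.
The Lagrangian is constant along horizontal directions, and R measures the failure of horizontal
directions to commute, so R takes values in the kernel of the vertical differential of L
(`fderiv_curvature`). At v that differential is g_v(v, ·).

Assertion 1. Differentiating Ric(v) = R^c_{cb} v^b gives Ric_a + (∂_a R^c_{cb}) v^b. By Bianchi, and
by Euler's identity for R (homogeneous of degree one), the second term is Ric_a + χ_a. Hence ∂_a Ric
= 2 Ric_a + χ_a identically (`dv_ricciScalar`), and the two field equations agree.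

Assertion 2. Since dL ≠ 0 at n, the locus L < 0 has a single local branch there, so every null
vector near n is again future-directed lightlike. Null convergence then makes n a local minimum of
Ric on the null cone of its tangent space. A Lagrange multiplier shows that the vertical
differential of Ric at n is proportional to g_n(n, ·), which vanishes on TH
(`dv_ricciScalar_eq_zero`). The field equation turns this into Ric_n|_{TH} = 0.

Assertion 3. Symmetry of the second derivatives of n in D_X n = ω(X) n gives R_n(X, Y) = dω(X, Y) n
on TH (`curvature_eq_smul`). As R_n has values in TH, a transverse direction adds nothing to the
trace, and on TH the map X ↦ R_n(X, Y) is a multiple of n; its trace is Ric_n(Y) = dω(n, Y)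
(`ricciForm_eq_extDeriv`). Antisymmetry gives Ric(n) = 0. If ω is not differentiable, n is first
rescaled so that a fixed covector equals one on it, which makes the new ω differentiable
(`ricciScalar_eq_zero`). The last claim follows by combining this with assertion 2. -/

noncomputable section

namespace LocalFinsler

variable {d : ℕ} {V : Type*} [NormedAddCommGroup V] [NormedSpace ℝ V]
  {U : Set (EuclideanSpace ℝ (Fin d) × EuclideanSpace ℝ (Fin d))}

/-! ### Positively homogeneous functions -/

/-- `f` is positively homogeneous of degree `k` in the second variable on `U`. -/
def PosHomogOn (U : Set (EuclideanSpace ℝ (Fin d) × EuclideanSpace ℝ (Fin d))) (k : ℕ)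
    (f : EuclideanSpace ℝ (Fin d) × EuclideanSpace ℝ (Fin d) → V) : Prop :=
  ∀ z ∈ U, ∀ s : ℝ, 0 < s → f (z.1, s • z.2) = s ^ k • f z

/-- `U` is stable under positive rescalings of the second variable. -/
def IsConic (U : Set (EuclideanSpace ℝ (Fin d) × EuclideanSpace ℝ (Fin d))) : Prop :=
  ∀ z ∈ U, ∀ s : ℝ, 0 < s → (z.1, s • z.2) ∈ U

/-- Rescaling of the second variable, as a continuous linear map. -/
def fiberScale (s : ℝ) : EuclideanSpace ℝ (Fin d) × EuclideanSpace ℝ (Fin d) →L[ℝ]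
    EuclideanSpace ℝ (Fin d) × EuclideanSpace ℝ (Fin d) :=
  (ContinuousLinearMap.fst ℝ _ _).prod (s • ContinuousLinearMap.snd ℝ _ _)

@[simp] lemma fiberScale_apply (s : ℝ)
    (z : EuclideanSpace ℝ (Fin d) × EuclideanSpace ℝ (Fin d)) :
    fiberScale s z = (z.1, s • z.2) := rfl

/-- Chain rule applied to f ∘ `fiberScale s` = s^k f. Treating both slots at once yields the two
rules below: x-derivatives keep the degree, v-derivatives lower it by one. -/
lemma PosHomogOn.fderiv_apply {k : ℕ}
    {f : EuclideanSpace ℝ (Fin d) × EuclideanSpace ℝ (Fin d) → V} (hf : PosHomogOn U k f)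
    (hU : IsOpen U) (hc : IsConic U) (hd : ∀ z ∈ U, DifferentiableAt ℝ f z)
    {z : EuclideanSpace ℝ (Fin d) × EuclideanSpace ℝ (Fin d)} (hz : z ∈ U) {s : ℝ} (hs : 0 < s)
    (w : EuclideanSpace ℝ (Fin d) × EuclideanSpace ℝ (Fin d)) :
    fderiv ℝ f (z.1, s • z.2) (w.1, s • w.2) = s ^ k • fderiv ℝ f z w := by
  have h1 : (fun y => f (fiberScale s y)) =ᶠ[nhds z] fun y => s ^ k • f y := by
    filter_upwards [hU.mem_nhds hz] with y hy using hf y hy s hs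
  have h2 : HasFDerivAt (fun y => f (fiberScale s y))
      ((fderiv ℝ f (z.1, s • z.2)).comp (fiberScale s)) z :=
    HasFDerivAt.comp z (g := f) (f := fiberScale s) (hd _ (hc z hz s hs)).hasFDerivAt
      (fiberScale s).hasFDerivAt
  have h3 : HasFDerivAt (fun y => s ^ k • f y) (s ^ k • fderiv ℝ f z) z :=
    (hd z hz).hasFDerivAt.const_smul _
  have := congrArg (fun T => T w) (h2.unique (h3.congr_of_eventuallyEq h1))
  simpa using this

lemma PosHomogOn.dx {k : ℕ}
    {f : EuclideanSpace ℝ (Fin d) × EuclideanSpace ℝ (Fin d) → V} (hf : PosHomogOn U k f)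
    (hU : IsOpen U) (hc : IsConic U) (hd : ∀ z ∈ U, DifferentiableAt ℝ f z)
    (X : EuclideanSpace ℝ (Fin d)) : PosHomogOn U k (fun z => LocalFinsler.dx f z X) := by
  intro z hz s hs
  simpa [LocalFinsler.dx] using hf.fderiv_apply hU hc hd hz hs (X, 0)

lemma PosHomogOn.dv {k : ℕ}
    {f : EuclideanSpace ℝ (Fin d) × EuclideanSpace ℝ (Fin d) → V} (hf : PosHomogOn U (k + 1) f)
    (hU : IsOpen U) (hc : IsConic U) (hd : ∀ z ∈ U, DifferentiableAt ℝ f z)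
    (X : EuclideanSpace ℝ (Fin d)) : PosHomogOn U k (fun z => LocalFinsler.dv f z X) := by
  intro z hz s hs
  have h : s • LocalFinsler.dv f (z.1, s • z.2) X = s ^ (k + 1) • LocalFinsler.dv f z X := by
    have := hf.fderiv_apply hU hc hd hz hs (0, X)
    rwa [show ((0 : EuclideanSpace ℝ (Fin d)), s • X) = s • (0, X) by simp,
      ContinuousLinearMap.map_smul] at this
  rw [pow_succ', mul_smul] at h
  exact smul_right_injective V hs.ne' h

/-- Euler's identity. -/
lemma PosHomogOn.euler {k : ℕ}
    {f : EuclideanSpace ℝ (Fin d) × EuclideanSpace ℝ (Fin d) → V} (hf : PosHomogOn U k f)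
    {z : EuclideanSpace ℝ (Fin d) × EuclideanSpace ℝ (Fin d)} (hz : z ∈ U)
    (hd : DifferentiableAt ℝ f z) : LocalFinsler.dv f z z.2 = (k : ℝ) • f z := by
  have h0 : (fun s : ℝ => f (z.1, s • z.2)) =ᶠ[nhds 1] fun s => s ^ k • f z := by
    filter_upwards [lt_mem_nhds (zero_lt_one' ℝ)] with s hs using hf z hz s hs
  have h1 : HasDerivAt (fun s : ℝ => (z.1, s • z.2)) ((0 : EuclideanSpace ℝ (Fin d)), z.2) 1 := by
    simpa using (hasDerivAt_const (1 : ℝ) z.1).prodMk ((hasDerivAt_id (1 : ℝ)).smul_const z.2)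
  have h2 : HasDerivAt (fun s : ℝ => f (z.1, s • z.2)) (LocalFinsler.dv f z z.2) 1 := by
    refine HasFDerivAt.comp_hasDerivAt (1 : ℝ) (l := f) ?_ h1
    simpa using hd.hasFDerivAt
  have h3 : HasDerivAt (fun s : ℝ => s ^ k • f z) ((k : ℝ) • f z) 1 := by
    simpa using (hasDerivAt_pow k (1 : ℝ)).smul_const (f z)
  exact h2.unique (h3.congr_of_eventuallyEq h0)

/-! ### Second derivatives -/

lemma contDiffAt_fderiv {f : EuclideanSpace ℝ (Fin d) × EuclideanSpace ℝ (Fin d) → V}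
    {z : EuclideanSpace ℝ (Fin d) × EuclideanSpace ℝ (Fin d)} (hf : ContDiffAt ℝ ∞ f z) :
    ContDiffAt ℝ ∞ (fderiv ℝ f) z :=
  hf.fderiv_right (by simp)

lemma fderiv_fderiv_comm {f : EuclideanSpace ℝ (Fin d) × EuclideanSpace ℝ (Fin d) → V}
    {z : EuclideanSpace ℝ (Fin d) × EuclideanSpace ℝ (Fin d)} (hf : ContDiffAt ℝ ∞ f z)
    (a b : EuclideanSpace ℝ (Fin d) × EuclideanSpace ℝ (Fin d)) :
    fderiv ℝ (fderiv ℝ f) z a b = fderiv ℝ (fderiv ℝ f) z b a :=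
  (hf.isSymmSndFDerivAt (by simpa using ENat.LEInfty.out)).eq a b

lemma hasFDerivAt_fderiv_apply
    {f : EuclideanSpace ℝ (Fin d) × EuclideanSpace ℝ (Fin d) → V}
    {c : EuclideanSpace ℝ (Fin d) × EuclideanSpace ℝ (Fin d) →
      EuclideanSpace ℝ (Fin d) × EuclideanSpace ℝ (Fin d)}
    {c' : EuclideanSpace ℝ (Fin d) × EuclideanSpace ℝ (Fin d) →L[ℝ]
      EuclideanSpace ℝ (Fin d) × EuclideanSpace ℝ (Fin d)}
    {z : EuclideanSpace ℝ (Fin d) × EuclideanSpace ℝ (Fin d)} (hf : ContDiffAt ℝ ∞ f z)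
    (hc : HasFDerivAt c c' z) :
    HasFDerivAt (fun y => fderiv ℝ f y (c y))
      ((fderiv ℝ f z).comp c' + (fderiv ℝ (fderiv ℝ f) z).flip (c z)) z :=
  ((contDiffAt_fderiv hf).differentiableAt (by simp)).hasFDerivAt.clm_apply hc

lemma fderiv_fderiv_apply_const
    {f : EuclideanSpace ℝ (Fin d) × EuclideanSpace ℝ (Fin d) → V}
    {z : EuclideanSpace ℝ (Fin d) × EuclideanSpace ℝ (Fin d)} (hf : ContDiffAt ℝ ∞ f z)
    (a b : EuclideanSpace ℝ (Fin d) × EuclideanSpace ℝ (Fin d)) :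
    fderiv ℝ (fun y => fderiv ℝ f y b) z a = fderiv ℝ (fderiv ℝ f) z a b := by
  rw [(hasFDerivAt_fderiv_apply hf (hasFDerivAt_const b z)).fderiv]
  simp

lemma contDiffAt_dv {f : EuclideanSpace ℝ (Fin d) × EuclideanSpace ℝ (Fin d) → V}
    {z : EuclideanSpace ℝ (Fin d) × EuclideanSpace ℝ (Fin d)} (hf : ContDiffAt ℝ ∞ f z)
    (X : EuclideanSpace ℝ (Fin d)) : ContDiffAt ℝ ∞ (fun y => dv f y X) z :=
  (contDiffAt_fderiv hf).clm_apply contDiffAt_const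

lemma contDiffAt_dx {f : EuclideanSpace ℝ (Fin d) × EuclideanSpace ℝ (Fin d) → V}
    {z : EuclideanSpace ℝ (Fin d) × EuclideanSpace ℝ (Fin d)} (hf : ContDiffAt ℝ ∞ f z)
    (X : EuclideanSpace ℝ (Fin d)) : ContDiffAt ℝ ∞ (fun y => dx f y X) z :=
  (contDiffAt_fderiv hf).clm_apply contDiffAt_const

/-! ### Lagrangians -/

/-- `ℓ` is a smooth Lagrangian on the open cone `U`, positively homogeneous of degree two, with
nondegenerate vertical Hessian. -/
structure IsLagrangianOn (ℓ : EuclideanSpace ℝ (Fin d) × EuclideanSpace ℝ (Fin d) → ℝ)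
    (U : Set (EuclideanSpace ℝ (Fin d) × EuclideanSpace ℝ (Fin d))) : Prop where
  isOpen : IsOpen U
  isConic : IsConic U
  smooth : ∀ z ∈ U, ContDiffAt ℝ ∞ ℓ z
  homog : PosHomogOn U 2 ℓ
  isUnit_det : ∀ z ∈ U, IsUnit (metricMatrix ℓ z).det

namespace IsLagrangianOn

variable {ℓ : EuclideanSpace ℝ (Fin d) × EuclideanSpace ℝ (Fin d) → ℝ}
  {z : EuclideanSpace ℝ (Fin d) × EuclideanSpace ℝ (Fin d)}

lemma differentiableAt (h : IsLagrangianOn ℓ U) (hz : z ∈ U) : DifferentiableAt ℝ ℓ z :=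
  (h.smooth z hz).differentiableAt (by simp)

lemma contDiffAt_metricMatrix (h : IsLagrangianOn ℓ U) (hz : z ∈ U) (i j : Fin d) :
    ContDiffAt ℝ ∞ (fun y => metricMatrix ℓ y i j) z :=
  contDiffAt_dv (contDiffAt_dv (h.smooth z hz) _) _

lemma contDiffAt_det {n : Type*} [Fintype n] [DecidableEq n]
    {A : EuclideanSpace ℝ (Fin d) × EuclideanSpace ℝ (Fin d) → Matrix n n ℝ}
    (hA : ∀ i j, ContDiffAt ℝ ∞ (fun y => A y i j) z) :
    ContDiffAt ℝ ∞ (fun y => (A y).det) z := by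
  simp only [Matrix.det_apply]
  exact ContDiffAt.sum fun σ _ => (contDiffAt_prod fun i _ => hA _ _).const_smul _

/-- Cramer's rule writes the entries of the inverse as quotients of determinants, hence of
polynomials in the entries of the metric. -/
lemma contDiffAt_inv_metricMatrix (h : IsLagrangianOn ℓ U) (hz : z ∈ U) (i j : Fin d) :
    ContDiffAt ℝ ∞ (fun y => (metricMatrix ℓ y)⁻¹ i j) z := by
  have h1 : (fun y => (metricMatrix ℓ y)⁻¹ i j) =
      fun y => ((metricMatrix ℓ y).det)⁻¹ * ((metricMatrix ℓ y).updateRow j (Pi.single i 1)).det := by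
    ext y
    rw [Matrix.inv_def, Matrix.smul_apply, Matrix.adjugate_apply, Ring.inverse_eq_inv', smul_eq_mul]
  rw [h1]
  refine ((contDiffAt_det (h.contDiffAt_metricMatrix hz)).inv (h.isUnit_det z hz).ne_zero).mul
    (contDiffAt_det fun a b => ?_)
  by_cases ha : a = j
  · subst ha
    simpa using contDiffAt_const
  · simpa [Matrix.updateRow_ne ha] using h.contDiffAt_metricMatrix hz a b

/-- The spray is smooth. -/
lemma contDiffAt_spray (h : IsLagrangianOn ℓ U) (hz : z ∈ U) : ContDiffAt ℝ ∞ (spray ℓ) z := by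
  refine (contDiffAt_euclidean (𝕜 := ℝ)).2 fun a => ?_
  refine contDiffAt_const.mul (ContDiffAt.sum fun c _ => (h.contDiffAt_inv_metricMatrix hz a c).mul ?_)
  refine ContDiffAt.sub ?_ (contDiffAt_dx (h.smooth z hz) _)
  exact (contDiffAt_fderiv (contDiffAt_dv (h.smooth z hz) _)).clm_apply
    (contDiffAt_snd.prodMk contDiffAt_const)

/-- The Hessian has degree zero, ∂ℓ/∂x has degree two, and (∂²ℓ/∂x∂v)v gets one degree from the
mixed derivative and one from the explicit factor v. -/
lemma posHomogOn_spray (h : IsLagrangianOn ℓ U) : PosHomogOn U 2 (spray ℓ) := by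
  intro z hz s hs
  have hd1 : ∀ z ∈ U, DifferentiableAt ℝ ℓ z := fun z hz => h.differentiableAt hz
  have hd2 : ∀ X, ∀ z ∈ U, DifferentiableAt ℝ (fun y => dv ℓ y X) z := fun X z hz =>
    (contDiffAt_dv (h.smooth z hz) _).differentiableAt (by simp)
  have hg : metricMatrix ℓ (z.1, s • z.2) = metricMatrix ℓ z := by
    ext i j
    simpa [metricMatrix] using ((h.homog.dv (k := 1) h.isOpen h.isConic hd1 (basisVec j)).dv (k := 0)
      h.isOpen h.isConic (hd2 _) (basisVec i)) z hz s hs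
  ext a
  simp only [spray, hg, PiLp.smul_apply, smul_eq_mul]
  rw [Finset.mul_sum, Finset.mul_sum, Finset.mul_sum]
  refine Finset.sum_congr rfl fun c _ => ?_
  have h1 := (h.homog.dx h.isOpen h.isConic hd1 (basisVec c)) z hz s hs
  have h2 := ((h.homog.dv (k := 1) h.isOpen h.isConic hd1 (basisVec c)).dx h.isOpen h.isConic
    (hd2 _) (s • z.2)) z hz s hs
  have h3 : dx (fun y => dv ℓ y (basisVec c)) z (s • z.2) =
      s * dx (fun y => dv ℓ y (basisVec c)) z z.2 := by
    rw [dx, dx, show (s • z.2, (0 : EuclideanSpace ℝ (Fin d))) = s • (z.2, 0) by simp, map_smul,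
      smul_eq_mul]
  simp only [smul_eq_mul] at h1 h2
  rw [h1, h2, h3]
  ring

lemma posHomogOn_nonlinConn (h : IsLagrangianOn ℓ U) (X : EuclideanSpace ℝ (Fin d)) :
    PosHomogOn U 1 (fun y => nonlinConn ℓ y X) :=
  h.posHomogOn_spray.dv h.isOpen h.isConic
    (fun _ hz => (h.contDiffAt_spray hz).differentiableAt (by simp)) X

lemma contDiffAt_nonlinConn (h : IsLagrangianOn ℓ U) (hz : z ∈ U) (X : EuclideanSpace ℝ (Fin d)) :
    ContDiffAt ℝ ∞ (fun y => nonlinConn ℓ y X) z :=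
  contDiffAt_dv (h.contDiffAt_spray hz) X

end IsLagrangianOn

end LocalFinsler

namespace LocalFinsler

variable {d : ℕ} {U : Set (EuclideanSpace ℝ (Fin d) × EuclideanSpace ℝ (Fin d))}

namespace IsLagrangianOn

variable {ℓ : EuclideanSpace ℝ (Fin d) × EuclideanSpace ℝ (Fin d) → ℝ}
  {z : EuclideanSpace ℝ (Fin d) × EuclideanSpace ℝ (Fin d)}

/-! ### Horizontal constancy of the Lagrangian -/

lemma euler (h : IsLagrangianOn ℓ U) (hz : z ∈ U) : fderiv ℝ ℓ z (0, z.2) = 2 * ℓ z := by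
  simpa [dv] using h.homog.euler hz (h.differentiableAt hz)

/-- The derivative of Euler's identity. -/
lemma hessian_apply_fiber (h : IsLagrangianOn ℓ U) (hz : z ∈ U)
    (w : EuclideanSpace ℝ (Fin d) × EuclideanSpace ℝ (Fin d)) :
    fderiv ℝ (fderiv ℝ ℓ) z w (0, z.2) + fderiv ℝ ℓ z (0, w.2) = 2 * fderiv ℝ ℓ z w := by
  have h1 : (fun y => fderiv ℝ ℓ y (0, y.2)) =ᶠ[nhds z] fun y => 2 * ℓ y := by
    filter_upwards [h.isOpen.mem_nhds hz] with y hy using h.euler hy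
  have h2 := hasFDerivAt_fderiv_apply (h.smooth z hz)
    ((hasFDerivAt_const (0 : EuclideanSpace ℝ (Fin d)) z).prodMk (hasFDerivAt_snd (p := z)))
  have h3 := (h.differentiableAt hz).hasFDerivAt.const_mul (2 : ℝ)
  have := congrArg (fun T => T w) (h2.unique (h3.congr_of_eventuallyEq h1))
  simpa [add_comm] using this

lemma metric_apply_fiber (h : IsLagrangianOn ℓ U) (hz : z ∈ U) (X : EuclideanSpace ℝ (Fin d)) :
    fderiv ℝ (fderiv ℝ ℓ) z (0, X) (0, z.2) = fderiv ℝ ℓ z (0, X) := by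
  linarith [h.hessian_apply_fiber hz (0, X)]

lemma sum_basisVec (X : EuclideanSpace ℝ (Fin d)) : ∑ i, X i • basisVec i = X := by
  ext j
  simp [basisVec, Pi.single_apply]

lemma metricMatrix_apply (h : IsLagrangianOn ℓ U) (hz : z ∈ U) (i j : Fin d) :
    metricMatrix ℓ z i j = fderiv ℝ (fderiv ℝ ℓ) z (0, basisVec i) (0, basisVec j) :=
  fderiv_fderiv_apply_const (h.smooth z hz) _ _

lemma map_inr_eq_sum {V : Type*} [NormedAddCommGroup V] [NormedSpace ℝ V]
    (T : EuclideanSpace ℝ (Fin d) × EuclideanSpace ℝ (Fin d) →L[ℝ] V)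
    (X : EuclideanSpace ℝ (Fin d)) : T (0, X) = ∑ i, X i • T (0, basisVec i) := by
  have : ((0 : EuclideanSpace ℝ (Fin d)), X) = ∑ i, X i • (0, basisVec i) := by
    refine Prod.ext ?_ ?_
    · simp [Prod.fst_sum]
    · simp [Prod.snd_sum, sum_basisVec]
  rw [this, map_sum]
  exact Finset.sum_congr rfl fun i _ => map_smul _ _ _

lemma map_inl_eq_sum {V : Type*} [NormedAddCommGroup V] [NormedSpace ℝ V]
    (T : EuclideanSpace ℝ (Fin d) × EuclideanSpace ℝ (Fin d) →L[ℝ] V)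
    (X : EuclideanSpace ℝ (Fin d)) : T (X, 0) = ∑ i, X i • T (basisVec i, 0) := by
  have : (X, (0 : EuclideanSpace ℝ (Fin d))) = ∑ i, X i • (basisVec i, 0) := by
    refine Prod.ext ?_ ?_
    · simp [Prod.fst_sum, sum_basisVec]
    · simp [Prod.snd_sum]
  rw [this, map_sum]
  exact Finset.sum_congr rfl fun i _ => map_smul _ _ _

/-- The defining equation of the spray, without the inverse of the metric. -/
lemma metric_spray (h : IsLagrangianOn ℓ U) (hz : z ∈ U) (W : EuclideanSpace ℝ (Fin d)) :
    2 * fderiv ℝ (fderiv ℝ ℓ) z (0, W) (0, spray ℓ z) =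
      fderiv ℝ (fderiv ℝ ℓ) z (z.2, 0) (0, W) - fderiv ℝ ℓ z (W, 0) := by
  have key : ∀ i, 2 * fderiv ℝ (fderiv ℝ ℓ) z (0, basisVec i) (0, spray ℓ z) =
      fderiv ℝ (fderiv ℝ ℓ) z (z.2, 0) (0, basisVec i) - fderiv ℝ ℓ z (basisVec i, 0) := by
    intro i
    set b : Fin d → ℝ := fun c =>
      dx (fun y => dv ℓ y (basisVec c)) z z.2 - dx ℓ z (basisVec c) with hb
    have h1 : ∀ a, spray ℓ z a = (1 / 2 : ℝ) * ((metricMatrix ℓ z)⁻¹.mulVec b) a := fun a => rfl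
    have h2 : (metricMatrix ℓ z).mulVec ((metricMatrix ℓ z)⁻¹.mulVec b) = b := by
      rw [Matrix.mulVec_mulVec, Matrix.mul_nonsing_inv _ (h.isUnit_det z hz), Matrix.one_mulVec]
    rw [map_inr_eq_sum]
    have h3 : b i = fderiv ℝ (fderiv ℝ ℓ) z (z.2, 0) (0, basisVec i)
        - fderiv ℝ ℓ z (basisVec i, 0) := by
      simp only [hb, dx, dv]
      rw [fderiv_fderiv_apply_const (h.smooth z hz)]
    rw [← h3, ← congrFun h2 i, Matrix.mulVec, dotProduct, Finset.mul_sum]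
    refine Finset.sum_congr rfl fun a _ => ?_
    rw [h1, h.metricMatrix_apply hz, smul_eq_mul]
    ring
  have e1 : fderiv ℝ (fderiv ℝ ℓ) z (0, W) (0, spray ℓ z) =
      ∑ i, W i * fderiv ℝ (fderiv ℝ ℓ) z (0, basisVec i) (0, spray ℓ z) := by
    simpa using map_inr_eq_sum ((fderiv ℝ (fderiv ℝ ℓ) z).flip (0, spray ℓ z)) W
  rw [e1, map_inr_eq_sum _ W, map_inl_eq_sum _ W, Finset.mul_sum, ← Finset.sum_sub_distrib]
  refine Finset.sum_congr rfl fun i _ => ?_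
  rw [smul_eq_mul, smul_eq_mul, ← mul_sub, ← key i]
  ring

/-- The spray equation contracted with v, simplified by g_v(v, ·) = ∂ℓ/∂v and Euler's identity. Its
vertical derivative is what yields horizontal constancy of ℓ. -/
lemma fderiv_spray (h : IsLagrangianOn ℓ U) (hz : z ∈ U) :
    2 * fderiv ℝ ℓ z (0, spray ℓ z) = fderiv ℝ ℓ z (z.2, 0) := by
  have h1 := h.metric_spray hz z.2
  have h2 := h.metric_apply_fiber hz (spray ℓ z)
  have h3 := h.hessian_apply_fiber hz (z.2, 0)
  simp only [Prod.mk_zero_zero, map_zero] at h3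
  rw [fderiv_fderiv_comm (h.smooth z hz)] at h1
  linarith

lemma hasFDerivAt_spray (h : IsLagrangianOn ℓ U) (hz : z ∈ U) :
    HasFDerivAt (spray ℓ) (fderiv ℝ (spray ℓ) z) z :=
  ((h.contDiffAt_spray hz).differentiableAt (by simp)).hasFDerivAt

/-- The Lagrangian is constant in the horizontal directions. -/
lemma fderiv_horizontal (h : IsLagrangianOn ℓ U) (hz : z ∈ U) (X : EuclideanSpace ℝ (Fin d)) :
    fderiv ℝ ℓ z (X, -nonlinConn ℓ z X) = 0 := by
  have h1 : (fun y => 2 * fderiv ℝ ℓ y (0, spray ℓ y)) =ᶠ[nhds z]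
      fun y => fderiv ℝ ℓ y (y.2, 0) := by
    filter_upwards [h.isOpen.mem_nhds hz] with y hy using h.fderiv_spray hy
  have h2 := (hasFDerivAt_fderiv_apply (h.smooth z hz)
    ((hasFDerivAt_const (0 : EuclideanSpace ℝ (Fin d)) z).prodMk
      (h.hasFDerivAt_spray hz))).const_mul (2 : ℝ)
  have h3 := hasFDerivAt_fderiv_apply (h.smooth z hz)
    ((hasFDerivAt_snd (p := z)).prodMk (hasFDerivAt_const (0 : EuclideanSpace ℝ (Fin d)) z))
  have h4 := congrArg (fun T => T (0, X)) (h2.unique (h3.congr_of_eventuallyEq h1))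
  have h5 := h.metric_spray hz X
  rw [fderiv_fderiv_comm (h.smooth z hz) (z.2, 0)] at h5
  have h6 : (X, -nonlinConn ℓ z X) = (X, 0) - (0, nonlinConn ℓ z X) := by simp
  rw [h6, map_sub]
  simp only [smul_apply, add_apply,
    ContinuousLinearMap.comp_apply, ContinuousLinearMap.prod_apply,
    zero_apply, ContinuousLinearMap.flip_apply,
    ContinuousLinearMap.coe_snd', smul_eq_mul] at h4
  have h7 : nonlinConn ℓ z X = fderiv ℝ (spray ℓ) z (0, X) := rfl
  rw [h7]
  linarith

/-! ### The curvature -/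

lemma horizDeriv_eq (ℓ : EuclideanSpace ℝ (Fin d) × EuclideanSpace ℝ (Fin d) → ℝ)
    (f : EuclideanSpace ℝ (Fin d) × EuclideanSpace ℝ (Fin d) → EuclideanSpace ℝ (Fin d))
    (z : EuclideanSpace ℝ (Fin d) × EuclideanSpace ℝ (Fin d)) (X : EuclideanSpace ℝ (Fin d)) :
    horizDeriv ℓ f z X = fderiv ℝ f z (X, -nonlinConn ℓ z X) := by
  rw [show (X, -nonlinConn ℓ z X) = (X, 0) - (0, nonlinConn ℓ z X) by simp, map_sub]
  rfl

/-- The curvature is vertical-tangent to the level sets of the Lagrangian. -/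
lemma fderiv_curvature (h : IsLagrangianOn ℓ U) (hz : z ∈ U) (X Y : EuclideanSpace ℝ (Fin d)) :
    fderiv ℝ ℓ z (0, curvature ℓ z X Y) = 0 := by
  have key : ∀ X Y : EuclideanSpace ℝ (Fin d),
      fderiv ℝ ℓ z (0, horizDeriv ℓ (fun y => nonlinConn ℓ y X) z Y) =
        fderiv ℝ (fderiv ℝ ℓ) z (Y, -nonlinConn ℓ z Y) (X, -nonlinConn ℓ z X) := by
    intro X Y
    have h1 : (fun y => fderiv ℝ ℓ y (X, -nonlinConn ℓ y X)) =ᶠ[nhds z] fun _ => 0 := by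
      filter_upwards [h.isOpen.mem_nhds hz] with y hy using h.fderiv_horizontal hy X
    have h2 := hasFDerivAt_fderiv_apply (h.smooth z hz)
      ((hasFDerivAt_const X z).prodMk
        ((h.contDiffAt_nonlinConn hz X).differentiableAt (by simp)).hasFDerivAt.neg)
    have h3 := congrArg (fun T => T (Y, -nonlinConn ℓ z Y))
      (h2.unique ((hasFDerivAt_const (0 : ℝ) z).congr_of_eventuallyEq h1))
    simp only [add_apply, ContinuousLinearMap.comp_apply,
      ContinuousLinearMap.prod_apply, zero_apply, neg_apply,
      ContinuousLinearMap.flip_apply, Pi.neg_apply] at h3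
    rw [← horizDeriv_eq, show ((0 : EuclideanSpace ℝ (Fin d)),
      -horizDeriv ℓ (fun y => nonlinConn ℓ y X) z Y) =
      -(0, horizDeriv ℓ (fun y => nonlinConn ℓ y X) z Y) by simp, map_neg] at h3
    linarith
  rw [curvature, show ((0 : EuclideanSpace ℝ (Fin d)),
      horizDeriv ℓ (fun y => nonlinConn ℓ y Y) z X - horizDeriv ℓ (fun y => nonlinConn ℓ y X) z Y) =
      (0, horizDeriv ℓ (fun y => nonlinConn ℓ y Y) z X) -
      (0, horizDeriv ℓ (fun y => nonlinConn ℓ y X) z Y) by simp, map_sub, key, key,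
    fderiv_fderiv_comm (h.smooth z hz), sub_self]

/-- The curvature in terms of the second derivative of the spray. -/
lemma horizDeriv_nonlinConn (h : IsLagrangianOn ℓ U) (hz : z ∈ U)
    (X Y : EuclideanSpace ℝ (Fin d)) :
    horizDeriv ℓ (fun y => nonlinConn ℓ y Y) z X =
      fderiv ℝ (fderiv ℝ (spray ℓ)) z (X, -fderiv ℝ (spray ℓ) z (0, X)) (0, Y) := by
  rw [horizDeriv_eq]
  exact fderiv_fderiv_apply_const (h.contDiffAt_spray hz) _ _

/-- Expresses the derivative through the second and third derivatives of the spray alone, so that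
the Bianchi identity reduces to their symmetries. -/
lemma hasFDerivAt_horizDeriv (h : IsLagrangianOn ℓ U) (hz : z ∈ U)
    (X Y : EuclideanSpace ℝ (Fin d)) :
    ∃ T : EuclideanSpace ℝ (Fin d) × EuclideanSpace ℝ (Fin d) →L[ℝ] EuclideanSpace ℝ (Fin d),
      HasFDerivAt (horizDeriv ℓ (fun y => nonlinConn ℓ y Y) · X) T z ∧ ∀ w, T w =
        fderiv ℝ (fderiv ℝ (fderiv ℝ (spray ℓ))) z w (X, -nonlinConn ℓ z X) (0, Y) -
        fderiv ℝ (fderiv ℝ (spray ℓ)) z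
          (0, fderiv ℝ (fderiv ℝ (spray ℓ)) z w (0, X)) (0, Y) := by
  have hG := h.contDiffAt_spray hz
  have h1 : HasFDerivAt (fun y => (X, -fderiv ℝ (spray ℓ) y (0, X))) _ z :=
    (hasFDerivAt_const X z).prodMk
      (hasFDerivAt_fderiv_apply hG (hasFDerivAt_const ((0 : EuclideanSpace ℝ (Fin d)), X) z)).neg
  have h2 := (hasFDerivAt_fderiv_apply (contDiffAt_fderiv hG) h1).clm_apply
    (hasFDerivAt_const ((0 : EuclideanSpace ℝ (Fin d)), Y) z)
  refine ⟨_, h2.congr_of_eventuallyEq ?_, fun w => ?_⟩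
  · filter_upwards [h.isOpen.mem_nhds hz] with y hy using h.horizDeriv_nonlinConn hy X Y
  · simp only [add_apply, ContinuousLinearMap.comp_apply,
      ContinuousLinearMap.prod_apply, zero_apply, neg_apply,
      ContinuousLinearMap.flip_apply, map_zero, zero_add]
    rw [show ((0 : EuclideanSpace ℝ (Fin d)), -fderiv ℝ (fderiv ℝ (spray ℓ)) z w (0, X)) =
      -(0, fderiv ℝ (fderiv ℝ (spray ℓ)) z w (0, X)) by simp, map_neg, neg_apply,
      neg_add_eq_sub]
    rfl

lemma differentiableAt_curvature (h : IsLagrangianOn ℓ U) (hz : z ∈ U)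
    (X Y : EuclideanSpace ℝ (Fin d)) : DifferentiableAt ℝ (curvature ℓ · X Y) z := by
  obtain ⟨T, hT, -⟩ := h.hasFDerivAt_horizDeriv hz X Y
  obtain ⟨S, hS, -⟩ := h.hasFDerivAt_horizDeriv hz Y X
  exact (hT.sub hS).differentiableAt

lemma dv_curvature (h : IsLagrangianOn ℓ U) (hz : z ∈ U) (X Y Z : EuclideanSpace ℝ (Fin d)) :
    dv (curvature ℓ · X Y) z Z =
      (fderiv ℝ (fderiv ℝ (fderiv ℝ (spray ℓ))) z (0, Z) (X, -nonlinConn ℓ z X) (0, Y) -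
        fderiv ℝ (fderiv ℝ (spray ℓ)) z
          (0, fderiv ℝ (fderiv ℝ (spray ℓ)) z (0, Z) (0, X)) (0, Y)) -
      (fderiv ℝ (fderiv ℝ (fderiv ℝ (spray ℓ))) z (0, Z) (Y, -nonlinConn ℓ z Y) (0, X) -
        fderiv ℝ (fderiv ℝ (spray ℓ)) z
          (0, fderiv ℝ (fderiv ℝ (spray ℓ)) z (0, Z) (0, Y)) (0, X)) := by
  obtain ⟨T, hT, hT'⟩ := h.hasFDerivAt_horizDeriv hz X Y
  obtain ⟨S, hS, hS'⟩ := h.hasFDerivAt_horizDeriv hz Y X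
  rw [dv, (show HasFDerivAt (curvature ℓ · X Y) (T - S) z from hT.sub hS).fderiv,
    sub_apply, hT', hS']

/-- The derivative of the symmetry of the second derivative. With the symmetry in the first two
slots it gives total symmetry. -/
lemma fderiv_fderiv_fderiv_comm (h : IsLagrangianOn ℓ U) (hz : z ∈ U)
    (a b c : EuclideanSpace ℝ (Fin d) × EuclideanSpace ℝ (Fin d)) :
    fderiv ℝ (fderiv ℝ (fderiv ℝ (spray ℓ))) z a b c =
      fderiv ℝ (fderiv ℝ (fderiv ℝ (spray ℓ))) z a c b := by
  have hG := contDiffAt_fderiv (contDiffAt_fderiv (h.contDiffAt_spray hz))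
  have hd := (hG.differentiableAt (by simp)).hasFDerivAt
  have h1 := (hd.clm_apply (hasFDerivAt_const b z)).clm_apply (hasFDerivAt_const c z)
  have h2 := (hd.clm_apply (hasFDerivAt_const c z)).clm_apply (hasFDerivAt_const b z)
  have h3 := congrArg (fun T => T a) (h1.unique (h2.congr_of_eventuallyEq (by
    filter_upwards [h.isOpen.mem_nhds hz] with y hy using
      fderiv_fderiv_comm (h.contDiffAt_spray hy) b c)))
  simpa using h3

/-- The first Bianchi identity. -/
lemma bianchi (h : IsLagrangianOn ℓ U) (hz : z ∈ U) (X Y Z : EuclideanSpace ℝ (Fin d)) :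
    dv (curvature ℓ · X Y) z Z + dv (curvature ℓ · Y Z) z X + dv (curvature ℓ · Z X) z Y = 0 := by
  have hG := h.contDiffAt_spray hz
  -- The horizontal lift always occupies the middle slot; exchanging the outer two matches each
  -- third-order term with one of opposite sign in the cyclic sum. The terms quadratic in second
  -- derivatives cancel in pairs as well.
  have s3 : ∀ a b c, fderiv ℝ (fderiv ℝ (fderiv ℝ (spray ℓ))) z a b c =
      fderiv ℝ (fderiv ℝ (fderiv ℝ (spray ℓ))) z c b a := fun a b c => by
    rw [h.fderiv_fderiv_fderiv_comm hz a b c, fderiv_fderiv_comm (contDiffAt_fderiv hG) a c,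
      h.fderiv_fderiv_fderiv_comm hz c a b]
  rw [h.dv_curvature hz, h.dv_curvature hz, h.dv_curvature hz,
    s3 (0, Z) (X, -nonlinConn ℓ z X), s3 (0, Z) (Y, -nonlinConn ℓ z Y),
    s3 (0, X) (Z, -nonlinConn ℓ z Z), fderiv_fderiv_comm hG (0, Z) (0, X),
    fderiv_fderiv_comm hG (0, Z) (0, Y), fderiv_fderiv_comm hG (0, Y) (0, X)]
  abel

lemma posHomogOn_curvature (h : IsLagrangianOn ℓ U) (X Y : EuclideanSpace ℝ (Fin d)) :
    PosHomogOn U 1 (curvature ℓ · X Y) := by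
  have key : ∀ X Y : EuclideanSpace ℝ (Fin d),
      PosHomogOn U 1 (horizDeriv ℓ (fun y => nonlinConn ℓ y Y) · X) := by
    intro X Y z hz s hs
    have h1 := (h.posHomogOn_nonlinConn Y).fderiv_apply h.isOpen h.isConic
      (fun z hz => (h.contDiffAt_nonlinConn hz Y).differentiableAt (by simp)) hz hs
      (X, -nonlinConn ℓ z X)
    have h2 := h.posHomogOn_nonlinConn X z hz s hs
    simp only [horizDeriv_eq]
    rw [← h1, show nonlinConn ℓ (z.1, s • z.2) X = s ^ 1 • nonlinConn ℓ z X from h2]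
    simp
  intro z hz s hs
  simp only [curvature, smul_sub]
  rw [← key X Y z hz s hs, ← key Y X z hz s hs]

lemma curvature_swap (ℓ : EuclideanSpace ℝ (Fin d) × EuclideanSpace ℝ (Fin d) → ℝ)
    (z : EuclideanSpace ℝ (Fin d) × EuclideanSpace ℝ (Fin d)) (X Y : EuclideanSpace ℝ (Fin d)) :
    curvature ℓ z X Y = -curvature ℓ z Y X := by
  simp [curvature]

end IsLagrangianOn

end LocalFinsler

namespace LocalFinsler

variable {d : ℕ} {U : Set (EuclideanSpace ℝ (Fin d) × EuclideanSpace ℝ (Fin d))}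

namespace IsLagrangianOn

variable {ℓ : EuclideanSpace ℝ (Fin d) × EuclideanSpace ℝ (Fin d) → ℝ}
  {z : EuclideanSpace ℝ (Fin d) × EuclideanSpace ℝ (Fin d)}

/-! ### The Ricci 1-form and the Ricci scalar -/

/-- The curvature as a bilinear map. -/
def curvatureBilin (ℓ : EuclideanSpace ℝ (Fin d) × EuclideanSpace ℝ (Fin d) → ℝ)
    (z : EuclideanSpace ℝ (Fin d) × EuclideanSpace ℝ (Fin d)) :
    EuclideanSpace ℝ (Fin d) →L[ℝ] EuclideanSpace ℝ (Fin d) →L[ℝ] EuclideanSpace ℝ (Fin d) :=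
  let T := (fderiv ℝ (fderiv ℝ (spray ℓ)) z).bilinearComp
    ((ContinuousLinearMap.id ℝ _).prod
      (-((fderiv ℝ (spray ℓ) z).comp (ContinuousLinearMap.inr ℝ _ _))))
    (ContinuousLinearMap.inr ℝ (EuclideanSpace ℝ (Fin d)) (EuclideanSpace ℝ (Fin d)))
  T - T.flip

lemma curvature_eq_bilin (h : IsLagrangianOn ℓ U) (hz : z ∈ U) (X Y : EuclideanSpace ℝ (Fin d)) :
    curvature ℓ z X Y = curvatureBilin ℓ z X Y := by
  rw [curvature, h.horizDeriv_nonlinConn hz, h.horizDeriv_nonlinConn hz]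
  rfl

lemma curvature_eq_sum (h : IsLagrangianOn ℓ U) (hz : z ∈ U) (X Y : EuclideanSpace ℝ (Fin d)) :
    curvature ℓ z X Y = ∑ i, Y i • curvature ℓ z X (basisVec i) := by
  simp only [h.curvature_eq_bilin hz]
  conv_lhs => rw [← sum_basisVec Y, map_sum]
  simp

lemma contDiffAt_curvature (h : IsLagrangianOn ℓ U) (hz : z ∈ U)
    (X Y : EuclideanSpace ℝ (Fin d)) : ContDiffAt ℝ ∞ (curvature ℓ · X Y) z := by
  have key : ∀ X Y : EuclideanSpace ℝ (Fin d),
      ContDiffAt ℝ ∞ (horizDeriv ℓ (fun y => nonlinConn ℓ y Y) · X) z := by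
    intro X Y
    simp only [horizDeriv_eq]
    exact (contDiffAt_fderiv (h.contDiffAt_nonlinConn hz Y)).clm_apply
      (contDiffAt_const.prodMk (h.contDiffAt_nonlinConn hz X).neg)
  exact (key X Y).sub (key Y X)

lemma contDiffAt_ricciScalar (h : IsLagrangianOn ℓ U) (hz : z ∈ U) :
    ContDiffAt ℝ ∞ (ricciScalar ℓ) z := by
  have h1 : ContDiffAt ℝ ∞ (fun y : EuclideanSpace ℝ (Fin d) × EuclideanSpace ℝ (Fin d) =>
      ∑ c, ∑ i, y.2 i * curvature ℓ y (basisVec c) (basisVec i) c) z := by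
    refine ContDiffAt.sum fun c _ => ContDiffAt.sum fun i _ => ?_
    exact (contDiffAt_euclidean.1 (contDiffAt_snd (𝕜 := ℝ)) i).mul
      (contDiffAt_euclidean.1 (h.contDiffAt_curvature hz _ _) c)
  refine h1.congr_of_eventuallyEq ?_
  filter_upwards [h.isOpen.mem_nhds hz] with y hy
  simp only [ricciScalar, ricciForm]
  refine Finset.sum_congr rfl fun c _ => ?_
  rw [h.curvature_eq_sum hy (basisVec c) y.2]
  simp

/-- Product rule for R(X, v), where v is both base point and argument. Expanding in the basis
separates the two roles. -/
lemma hasFDerivAt_curvature_fiber (h : IsLagrangianOn ℓ U) (hz : z ∈ U)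
    (X : EuclideanSpace ℝ (Fin d)) :
    ∃ T : EuclideanSpace ℝ (Fin d) × EuclideanSpace ℝ (Fin d) →L[ℝ] EuclideanSpace ℝ (Fin d),
      HasFDerivAt (fun y => curvature ℓ y X y.2) T z ∧
      ∀ Z, T (0, Z) = dv (curvature ℓ · X z.2) z Z + curvature ℓ z X Z := by
  have hR : ∀ i, HasFDerivAt (curvature ℓ · X (basisVec i))
      (fderiv ℝ (curvature ℓ · X (basisVec i)) z) z := fun i =>
    (h.differentiableAt_curvature hz _ _).hasFDerivAt
  have hc : ∀ i, HasFDerivAt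
      (fun y : EuclideanSpace ℝ (Fin d) × EuclideanSpace ℝ (Fin d) => y.2 i)
      ((EuclideanSpace.proj i).comp (ContinuousLinearMap.snd ℝ _ _)) z := fun i =>
    (EuclideanSpace.proj i : EuclideanSpace ℝ (Fin d) →L[ℝ] ℝ).hasFDerivAt.comp z hasFDerivAt_snd
  have h1 := HasFDerivAt.fun_sum (u := Finset.univ) fun i _ => (hc i).smul (hR i)
  have h2 := HasFDerivAt.fun_sum (u := Finset.univ) fun i _ => (hR i).const_smul (z.2 i)
  have e1 := h1.congr_of_eventuallyEq (f₁ := fun y => curvature ℓ y X y.2) (by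
    filter_upwards [h.isOpen.mem_nhds hz] with y hy using h.curvature_eq_sum hy X y.2)
  have e2 := h2.congr_of_eventuallyEq (f₁ := fun y => curvature ℓ y X z.2) (by
    filter_upwards [h.isOpen.mem_nhds hz] with y hy using h.curvature_eq_sum hy X z.2)
  refine ⟨_, e1, fun Z => ?_⟩
  rw [dv, e2.fderiv, h.curvature_eq_sum hz X Z]
  simp [sum_apply, Finset.sum_add_distrib]

/-- The derivative of the Ricci scalar. -/
lemma dv_ricciScalar (h : IsLagrangianOn ℓ U) (hz : z ∈ U) (Y : EuclideanSpace ℝ (Fin d)) :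
    dv (ricciScalar ℓ) z Y = 2 * ricciForm ℓ z Y + chi ℓ z Y := by
  choose T hT hT' using fun c : Fin d => h.hasFDerivAt_curvature_fiber hz (basisVec c)
  have h1 : HasFDerivAt (ricciScalar ℓ) (∑ c, (EuclideanSpace.proj c).comp (T c)) z :=
    HasFDerivAt.fun_sum (u := Finset.univ) fun c _ =>
      (EuclideanSpace.proj c : EuclideanSpace ℝ (Fin d) →L[ℝ] ℝ).hasFDerivAt.comp z (hT c)
  have h2 : ∀ c, T c (0, Y) = dv (curvature ℓ · Y z.2) z (basisVec c) +
      (2 : ℝ) • curvature ℓ z (basisVec c) Y := by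
    intro c
    -- The fibre vector enters as a frozen argument. One of the three terms is then a derivative
    -- along v itself, which Euler's identity evaluates; another is the summand of χ up to sign.
    have b := h.bianchi hz (basisVec c) z.2 Y
    have e : dv (curvature ℓ · Y (basisVec c)) z z.2 = -curvature ℓ z (basisVec c) Y := by
      rw [(h.posHomogOn_curvature Y (basisVec c)).euler hz (h.differentiableAt_curvature hz _ _),
        curvature_swap]
      simp
    have e' : dv (curvature ℓ · z.2 Y) z (basisVec c) =
        -dv (curvature ℓ · Y z.2) z (basisVec c) := by
      have : (curvature ℓ · z.2 Y) = -(curvature ℓ · Y z.2) := by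
        ext1 y
        exact curvature_swap ℓ y z.2 Y
      rw [dv, dv, this, fderiv_neg]
      rfl
    rw [e, e'] at b
    rw [hT', two_smul, ← add_assoc]
    congr 1
    rw [add_assoc, ← neg_add, add_neg_eq_zero] at b
    exact b
  rw [dv, h1.fderiv, ricciForm, chi, sum_apply, Finset.mul_sum, ← Finset.sum_add_distrib]
  refine Finset.sum_congr rfl fun c _ => ?_
  rw [ContinuousLinearMap.comp_apply, h2]
  simp [add_comm]

/-- A trace computation. Splitting X = (X - λ(X)ξ) + λ(X)ξ writes φ as a sum of three rank-one maps,
with traces θ(φ n), a multiple of λ(n) = 0, and λ(φ ξ) = 0. -/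
lemma sum_apply_basisVec_of_ker {φ : EuclideanSpace ℝ (Fin d) →L[ℝ] EuclideanSpace ℝ (Fin d)}
    {lam θ : EuclideanSpace ℝ (Fin d) →L[ℝ] ℝ} {n ξ : EuclideanSpace ℝ (Fin d)}
    (hξ : lam ξ = 1) (hn : lam n = 0) (himg : ∀ X, lam (φ X) = 0)
    (hker : ∀ X, lam X = 0 → φ X = θ (φ X) • n) : ∑ c, φ (basisVec c) c = θ (φ n) := by
  have e : ∀ (μ : EuclideanSpace ℝ (Fin d) →L[ℝ] ℝ) (X : EuclideanSpace ℝ (Fin d)),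
      ∑ c, μ (basisVec c) * X c = μ X := fun μ X => by
    conv_rhs => rw [← sum_basisVec X, map_sum]
    simp [mul_comm]
  have h1 : ∀ c, φ (basisVec c) c = (θ.comp φ) (basisVec c) * n c -
      θ (φ ξ) * (lam (basisVec c) * n c) + lam (basisVec c) * φ ξ c := by
    intro c
    have := hker (basisVec c - lam (basisVec c) • ξ) (by simp [hξ])
    have := congrArg (fun X => X c) this
    simp only [map_sub, map_smul, PiLp.sub_apply, PiLp.smul_apply, smul_eq_mul] at this
    rw [ContinuousLinearMap.comp_apply]
    linarith
  simp only [h1, Finset.sum_add_distrib, Finset.sum_sub_distrib, ← Finset.mul_sum]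
  rw [e, e, e, hn, himg]
  simp

/-- The vertical derivative of the Lagrangian does not vanish off the zero section. -/
lemma exists_fderiv_eq_one (h : IsLagrangianOn ℓ U) (hz : z ∈ U) (hv : z.2 ≠ 0) :
    ∃ ξ, fderiv ℝ ℓ z (0, ξ) = 1 := by
  by_contra! hne
  have h0 : ∀ ξ, fderiv ℝ ℓ z (0, ξ) = 0 := by
    intro ξ
    by_contra hξ
    refine hne ((fderiv ℝ ℓ z (0, ξ))⁻¹ • ξ) ?_
    rw [show ((0 : EuclideanSpace ℝ (Fin d)), (fderiv ℝ ℓ z (0, ξ))⁻¹ • ξ) =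
      (fderiv ℝ ℓ z (0, ξ))⁻¹ • (0, ξ) by simp, map_smul, smul_eq_mul, inv_mul_cancel₀ hξ]
  have h1 : (metricMatrix ℓ z).mulVec z.2 = 0 := by
    ext i
    have := h.metric_apply_fiber hz (basisVec i)
    rw [h0, map_inr_eq_sum] at this
    rw [Matrix.mulVec, dotProduct, Pi.zero_apply, ← this]
    exact Finset.sum_congr rfl fun j _ => by rw [h.metricMatrix_apply hz, smul_eq_mul, mul_comm]
  apply hv
  ext i
  exact congrFun (Matrix.eq_zero_of_mulVec_eq_zero (h.isUnit_det z hz).ne_zero h1) i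

/-! ### Totally geodesic null hypersurfaces -/

section TotallyGeodesic

variable {V : Type*} [NormedAddCommGroup V] [NormedSpace ℝ V]
  {f N : V → EuclideanSpace ℝ (Fin d)} {τ : V → V →L[ℝ] ℝ} {y : V}

open Filter Topology

/-- The integrability condition for the equation `D_X N = τ(X) N` along `f`. -/
lemma curvature_eq_smul (h : IsLagrangianOn ℓ U) (hU : (f y, N y) ∈ U) (hf : ContDiffAt ℝ 2 f y)
    (hN : ∀ᶠ x in 𝓝 y, DifferentiableAt ℝ N x) (hτ : DifferentiableAt ℝ τ y)
    (heq : ∀ᶠ x in 𝓝 y, ∀ X,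
      fderiv ℝ N x X + nonlinConn ℓ (f x, N x) (fderiv ℝ f x X) = τ x X • N x) (X Y : V) :
    curvature ℓ (f y, N y) (fderiv ℝ f y X) (fderiv ℝ f y Y) =
      (fderiv ℝ τ y X Y - fderiv ℝ τ y Y X) • N y := by
  set G := spray ℓ with hG
  have hGs := h.contDiffAt_spray hU
  -- The equation solved for the derivative of N. The right-hand side is itself differentiable at y,
  -- so N has a second derivative there, and its symmetry is the integrability condition.
  let N' : V → V →L[ℝ] EuclideanSpace ℝ (Fin d) := fun x => (τ x).smulRight (N x) -
    ((fderiv ℝ G (f x, N x)).comp (ContinuousLinearMap.inr ℝ _ _)).comp (fderiv ℝ f x)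
  have hN' : ∀ᶠ x in 𝓝 y, HasFDerivAt N (N' x) x := by
    filter_upwards [hN, heq] with x hx hx'
    have : fderiv ℝ N x = N' x := by
      ext1 X
      exact eq_sub_of_add_eq (hx' X)
    rw [← this]
    exact hx.hasFDerivAt
  have hNy : HasFDerivAt N (N' y) y := hN'.self_of_nhds
  have hfy : HasFDerivAt f (fderiv ℝ f y) y := (hf.differentiableAt (by simp)).hasFDerivAt
  have hf' : HasFDerivAt (fderiv ℝ f) (fderiv ℝ (fderiv ℝ f) y) y :=
    ((hf.fderiv_right (m := 1) (by norm_num)).differentiableAt (by simp)).hasFDerivAt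
  have hGf : HasFDerivAt (fun x => fderiv ℝ G (f x, N x))
      ((fderiv ℝ (fderiv ℝ G) (f y, N y)).comp ((fderiv ℝ f y).prod (N' y))) y :=
    HasFDerivAt.comp y (g := fderiv ℝ G) (f := fun x => (f x, N x))
      ((contDiffAt_fderiv hGs).differentiableAt (by simp)).hasFDerivAt (hfy.prodMk hNy)
  have hdN' : DifferentiableAt ℝ N' y := by
    refine DifferentiableAt.sub ?_ ?_
    · exact ((ContinuousLinearMap.smulRightL ℝ V
        (EuclideanSpace ℝ (Fin d))).isBoundedBilinearMap.differentiableAt (τ y, N y)).comp y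
          (hτ.prodMk hNy.differentiableAt)
    · exact (hGf.differentiableAt.clm_comp (differentiableAt_const _)).clm_comp
        hf'.differentiableAt
  have hsymm := second_derivative_symmetric_of_eventually hN' hdN'.hasFDerivAt X Y
  have hNc : ∀ W : EuclideanSpace ℝ (Fin d), fderiv ℝ (fderiv ℝ G) (f y, N y) (0, N y) (0, W) =
      fderiv ℝ G (f y, N y) (0, W) := by
    intro W
    have := (h.posHomogOn_nonlinConn W).euler hU
      ((h.contDiffAt_nonlinConn hU W).differentiableAt (by simp))
    rw [Nat.cast_one, one_smul] at this
    rw [← fderiv_fderiv_apply_const hGs]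
    exact this
  have hval : ∀ X Y : V, fderiv ℝ N' y X Y =
      fderiv ℝ τ y X Y • N y + (τ y X * τ y Y) • N y
        - τ y Y • fderiv ℝ G (f y, N y) (0, fderiv ℝ f y X)
        - τ y X • fderiv ℝ G (f y, N y) (0, fderiv ℝ f y Y)
        - horizDeriv ℓ (fun x => nonlinConn ℓ x (fderiv ℝ f y Y)) (f y, N y) (fderiv ℝ f y X)
        - fderiv ℝ G (f y, N y) (0, fderiv ℝ (fderiv ℝ f) y X Y) := by
    intro X Y
    have h1 : HasFDerivAt (fun x => N' x Y) _ y :=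
      hdN'.hasFDerivAt.clm_apply (hasFDerivAt_const Y y)
    have h2 : HasFDerivAt (fun x => τ x Y • N x - fderiv ℝ G (f x, N x) (0, fderiv ℝ f x Y)) _ y :=
      ((hτ.hasFDerivAt.clm_apply (hasFDerivAt_const Y y)).smul hNy).sub
        (hGf.clm_apply ((hasFDerivAt_const (0 : EuclideanSpace ℝ (Fin d)) y).prodMk
          (hf'.clm_apply (hasFDerivAt_const Y y))))
    have h3 := congrArg (fun T => T X) (h1.unique h2)
    -- The velocity of (f, N) is the horizontal lift of f'X plus τ(X) times the fibre direction N.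
    -- The former produces the curvature terms; the latter, by `hNc`, terms that become symmetric in
    -- X and Y.
    have h4 : (fderiv ℝ f y X, N' y X) =
        (fderiv ℝ f y X, -fderiv ℝ (spray ℓ) (f y, N y) (0, fderiv ℝ f y X)) +
          τ y X • (0, N y) := by
      simp [N', hG, sub_eq_neg_add]
    simp only [add_apply, sub_apply, ContinuousLinearMap.comp_apply, zero_apply, map_zero,
      zero_add, ContinuousLinearMap.flip_apply, smul_apply, ContinuousLinearMap.prod_apply,
      ContinuousLinearMap.smulRight_apply] at h3
    rw [h3, h4, map_add, add_apply, map_smul, smul_apply, hNc, h.horizDeriv_nonlinConn hU]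
    simp only [N', sub_apply, ContinuousLinearMap.smulRight_apply, ContinuousLinearMap.comp_apply,
      ContinuousLinearMap.inr_apply, smul_sub, smul_smul, mul_comm (τ y Y)]
    abel
  rw [hval, hval, (hf.isSymmSndFDerivAt (by simp)).eq Y X, mul_comm (τ y Y)] at hsymm
  rw [curvature, sub_smul]
  have := sub_eq_zero.2 hsymm
  rw [← sub_eq_zero, ← neg_eq_zero, ← this]
  abel

/-- The Ricci 1-form of a totally geodesic null hypersurface. -/
lemma ricciForm_eq_extDeriv (h : IsLagrangianOn ℓ U) (hU : (f y, N y) ∈ U)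
    (hf : ContDiffAt ℝ 2 f y)
    (hN : ∀ᶠ x in 𝓝 y, DifferentiableAt ℝ N x) (hτ : DifferentiableAt ℝ τ y)
    (heq : ∀ᶠ x in 𝓝 y, ∀ X,
      fderiv ℝ N x X + nonlinConn ℓ (f x, N x) (fderiv ℝ f x X) = τ x X • N x)
    {n : V} (hn : fderiv ℝ f y n = N y) (hN0 : N y ≠ 0)
    (hker : ∀ W, fderiv ℝ ℓ (f y, N y) (0, W) = 0 ↔ W ∈ Set.range (fderiv ℝ f y)) (Y : V) :
    ricciForm ℓ (f y, N y) (fderiv ℝ f y Y) = fderiv ℝ τ y n Y - fderiv ℝ τ y Y n := by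
  obtain ⟨ξ, hξ⟩ := h.exists_fderiv_eq_one hU hN0
  obtain ⟨lam, hlam⟩ : ∃ lam : EuclideanSpace ℝ (Fin d) →L[ℝ] ℝ,
      ∀ W, lam W = fderiv ℝ ℓ (f y, N y) (0, W) :=
    ⟨(fderiv ℝ ℓ (f y, N y)).comp (ContinuousLinearMap.inr ℝ _ _), fun _ => rfl⟩
  obtain ⟨θ, hθ⟩ := SeparatingDual.exists_eq_one (R := ℝ) hN0
  obtain ⟨φ, hφ⟩ : ∃ φ : EuclideanSpace ℝ (Fin d) →L[ℝ] EuclideanSpace ℝ (Fin d),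
      ∀ X, φ X = curvature ℓ (f y, N y) X (fderiv ℝ f y Y) :=
    ⟨(curvatureBilin ℓ (f y, N y)).flip (fderiv ℝ f y Y), fun X => by
      rw [h.curvature_eq_bilin hU, ContinuousLinearMap.flip_apply]⟩
  have hφ' : ∀ X, φ (fderiv ℝ f y X) = (fderiv ℝ τ y X Y - fderiv ℝ τ y Y X) • N y := fun X => by
    rw [hφ, h.curvature_eq_smul hU hf hN hτ heq]
  have hn0 : lam (N y) = 0 := by rw [hlam, hker]; exact ⟨n, hn⟩
  have himg : ∀ X, lam (φ X) = 0 := fun X => by rw [hlam, hφ, h.fderiv_curvature hU]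
  have hrange : ∀ X, lam X = 0 → φ X = θ (φ X) • N y := fun X hX => by
    rw [hlam, hker] at hX
    obtain ⟨X, rfl⟩ := hX
    rw [hφ', map_smul, hθ, smul_eq_mul, mul_one]
  have htr := sum_apply_basisVec_of_ker ((hlam ξ).trans hξ) hn0 himg hrange
  have hφn : φ (N y) = (fderiv ℝ τ y n Y - fderiv ℝ τ y Y n) • N y := by rw [← hφ', hn]
  rw [hφn, map_smul, hθ, smul_eq_mul, mul_one] at htr
  rw [← htr, ricciForm]
  simp only [hφ]

/-- The Ricci scalar of a totally geodesic null hypersurface vanishes. -/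
lemma ricciScalar_eq_zero (h : IsLagrangianOn ℓ U) (hU : (f y, N y) ∈ U)
    (hf : ContDiffAt ℝ 2 f y)
    (hN : ∀ᶠ x in 𝓝 y, DifferentiableAt ℝ N x)
    (heq : ∀ᶠ x in 𝓝 y, ∀ X,
      fderiv ℝ N x X + nonlinConn ℓ (f x, N x) (fderiv ℝ f x X) = τ x X • N x)
    {n : V} (hn : fderiv ℝ f y n = N y) (hN0 : N y ≠ 0)
    (hker : ∀ W, fderiv ℝ ℓ (f y, N y) (0, W) = 0 ↔ W ∈ Set.range (fderiv ℝ f y)) :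
    ricciScalar ℓ (f y, N y) = 0 := by
  obtain ⟨θ, hθ⟩ := SeparatingDual.exists_eq_one (R := ℝ) hN0
  -- Normalization θ(N₁) = 1. Applying θ to the equation for N₁ removes the derivative of N₁ and
  -- leaves `τ₁` as the only possible coefficient; it is differentiable even when τ is not. At y
  -- nothing changes, since θ(N y) = 1.
  let ρ : V → ℝ := fun x => (θ (N x))⁻¹
  let N₁ : V → EuclideanSpace ℝ (Fin d) := fun x => ρ x • N x
  let τ₁ : V → V →L[ℝ] ℝ := fun x => (θ.comp ((fderiv ℝ (spray ℓ) (f x, N₁ x)).comp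
    (ContinuousLinearMap.inr ℝ _ _))).comp (fderiv ℝ f x)
  have hN₁y : N₁ y = N y := by simp [N₁, ρ, hθ]
  have hNy := hN.self_of_nhds
  have hpos : ∀ᶠ x in 𝓝 y, 0 < θ (N x) := by
    have : ContinuousAt (fun x => θ (N x)) y := θ.continuous.continuousAt.comp hNy.continuousAt
    exact this.eventually (lt_mem_nhds (by simp [hθ]))
  have hUx : ∀ᶠ x in 𝓝 y, (f x, N x) ∈ U :=
    (hf.continuousAt.prodMk hNy.continuousAt).eventually (h.isOpen.mem_nhds hU)
  have hρd : ∀ᶠ x in 𝓝 y, DifferentiableAt ℝ ρ x := by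
    filter_upwards [hN, hpos] with x hx hx'
    exact (θ.differentiableAt.comp x hx).inv hx'.ne'
  have hN₁d : ∀ᶠ x in 𝓝 y, DifferentiableAt ℝ N₁ x := by
    filter_upwards [hN, hρd] with x hx hx'
    exact hx'.smul hx
  have hτ₁ : DifferentiableAt ℝ τ₁ y := by
    have hG : DifferentiableAt ℝ (fun x => fderiv ℝ (spray ℓ) (f x, N₁ x)) y := by
      refine DifferentiableAt.comp y (g := fderiv ℝ (spray ℓ)) (f := fun x => (f x, N₁ x)) ?_
        ((hf.differentiableAt (by simp)).prodMk hN₁d.self_of_nhds)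
      rw [hN₁y]
      exact (contDiffAt_fderiv (h.contDiffAt_spray hU)).differentiableAt (by simp)
    exact ((differentiableAt_const θ).clm_comp (hG.clm_comp (differentiableAt_const _))).clm_comp
      ((hf.fderiv_right (m := 1) (by norm_num)).differentiableAt (by simp))
  have heq₁ : ∀ᶠ x in 𝓝 y, ∀ X,
      fderiv ℝ N₁ x X + nonlinConn ℓ (f x, N₁ x) (fderiv ℝ f x X) = τ₁ x X • N₁ x := by
    have hone : ∀ᶠ x in 𝓝 y, θ (N₁ x) = 1 := by
      filter_upwards [hpos] with x hx
      simp [N₁, ρ, inv_mul_cancel₀ hx.ne']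
    filter_upwards [hone.eventually_nhds, heq, hpos, hUx, hN, hρd, hN₁d] with
      x hx1 hx hxp hxU hxN hxρ hxN₁ X
    have e1 : fderiv ℝ N₁ x X = ρ x • fderiv ℝ N x X + fderiv ℝ ρ x X • N x := by
      rw [show N₁ = fun x => ρ x • N x from rfl, fderiv_fun_smul hxρ hxN]
      simp
    have e2 : nonlinConn ℓ (f x, N₁ x) (fderiv ℝ f x X) =
        ρ x • nonlinConn ℓ (f x, N x) (fderiv ℝ f x X) := by
      simpa using h.posHomogOn_nonlinConn (fderiv ℝ f x X) _ hxU (ρ x) (inv_pos.2 hxp)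
    obtain ⟨c, hc⟩ : ∃ c : ℝ,
        fderiv ℝ N₁ x X + nonlinConn ℓ (f x, N₁ x) (fderiv ℝ f x X) = c • N₁ x := by
      -- The second summand comes from the derivative of ρ, using N = θ(N) N₁.
      refine ⟨τ x X + fderiv ℝ ρ x X * θ (N x), ?_⟩
      rw [e1, e2, add_right_comm, ← smul_add, hx X]
      simp only [N₁, ρ, smul_smul, ← add_smul]
      congr 1
      field_simp
    have e3 : θ (fderiv ℝ N₁ x X) = 0 := by
      have h1 : HasFDerivAt (fun x => θ (N₁ x)) (θ.comp (fderiv ℝ N₁ x)) x :=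
        θ.hasFDerivAt.comp x hxN₁.hasFDerivAt
      have h2 := h1.unique ((hasFDerivAt_const (1 : ℝ) x).congr_of_eventuallyEq hx1)
      exact congrArg (fun T => T X) h2
    have e4 := congrArg θ hc
    rw [map_add, e3, zero_add, map_smul, hx1.self_of_nhds, smul_eq_mul, mul_one] at e4
    rw [hc, ← e4]
    rfl
  -- Evaluation at Y = n, where the antisymmetric right-hand side is zero.
  have := h.ricciForm_eq_extDeriv (N := N₁) (hN₁y ▸ hU) hf hN₁d hτ₁ heq₁ (hn.trans hN₁y.symm)
    (hN₁y ▸ hN0) (by rwa [hN₁y]) n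
  rwa [hN₁y, hn, sub_self] at this

end TotallyGeodesic

end IsLagrangianOn

end LocalFinsler

/-! ### Charts of the tangent bundle -/

section TangentCharts

variable {k : ℕ} {M : Type*} [TopologicalSpace M] [ChartedSpace (EuclideanSpace ℝ (Fin k)) M]

/-- The derivative of a chart, as an endomorphism of the model space. -/
def chartDeriv (e : OpenPartialHomeomorph M (EuclideanSpace ℝ (Fin k))) (p : M) :
    EuclideanSpace ℝ (Fin k) →L[ℝ] EuclideanSpace ℝ (Fin k) :=
  mfderiv (𝓡 k) (𝓡 k) e p

/-- The derivative of the inverse of a chart, as an endomorphism of the model space. -/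
def chartSymmDeriv (e : OpenPartialHomeomorph M (EuclideanSpace ℝ (Fin k)))
    (x : EuclideanSpace ℝ (Fin k)) : EuclideanSpace ℝ (Fin k) →L[ℝ] EuclideanSpace ℝ (Fin k) :=
  mfderiv (𝓡 k) (𝓡 k) e.symm x

lemma mdifferentiable_of_mem_maximalAtlas {c : WithTop ℕ∞} (hc : c ≠ 0)
    {e : OpenPartialHomeomorph M (EuclideanSpace ℝ (Fin k))}
    (he : e ∈ IsManifold.maximalAtlas (𝓡 k) c M) : e.MDifferentiable (𝓡 k) (𝓡 k) :=
  ⟨(contMDiffOn_of_mem_maximalAtlas he).mdifferentiableOn hc,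
    (contMDiffOn_symm_of_mem_maximalAtlas he).mdifferentiableOn hc⟩

lemma chartSymmDeriv_chartDeriv {e : OpenPartialHomeomorph M (EuclideanSpace ℝ (Fin k))}
    (he : e.MDifferentiable (𝓡 k) (𝓡 k)) {p : M} (hp : p ∈ e.source)
    (w : EuclideanSpace ℝ (Fin k)) : chartSymmDeriv e (e p) (chartDeriv e p w) = w :=
  congrArg (fun T => T w) (he.symm_comp_deriv hp)

lemma chartDeriv_chartSymmDeriv {e : OpenPartialHomeomorph M (EuclideanSpace ℝ (Fin k))}
    (he : e.MDifferentiable (𝓡 k) (𝓡 k)) {x : EuclideanSpace ℝ (Fin k)} (hx : x ∈ e.target)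
    (w : EuclideanSpace ℝ (Fin k)) : chartDeriv e (e.symm x) (chartSymmDeriv e x w) = w :=
  congrArg (fun T => T w) (he.comp_symm_deriv hx)

lemma tangentBundle_mk_congr {p q : M} {v w : EuclideanSpace ℝ (Fin k)} (hpq : p = q)
    (hvw : v = w) : (⟨p, v⟩ : TangentBundle (𝓡 k) M) = ⟨q, w⟩ := by
  subst hpq hvw; rfl

/-- The inverse of the chart of `TM` induced by a chart `e` of `M`. -/
def tangentOfCoords (e : OpenPartialHomeomorph M (EuclideanSpace ℝ (Fin k)))
    (z : EuclideanSpace ℝ (Fin k) × EuclideanSpace ℝ (Fin k)) : TangentBundle (𝓡 k) M :=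
  ⟨e.symm z.1, chartSymmDeriv e z.1 z.2⟩

lemma contMDiff_mk_tangentBundle_modelSpace {c : WithTop ℕ∞} :
    ContMDiff 𝓘(ℝ, EuclideanSpace ℝ (Fin k) × EuclideanSpace ℝ (Fin k)) (𝓡 k).tangent c
      (fun z : EuclideanSpace ℝ (Fin k) × EuclideanSpace ℝ (Fin k) =>
        (⟨z.1, z.2⟩ : TangentBundle (𝓡 k) (EuclideanSpace ℝ (Fin k)))) := by
  intro z
  refine Bundle.contMDiffAt_totalSpace.2 ⟨contDiff_fst.contMDiff.contMDiffAt, ?_⟩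
  simp only [trivializationAt_model_space_apply]
  exact contDiff_snd.contMDiff.contMDiffAt

lemma contMDiffOn_tangentOfCoords [IsManifold (𝓡 k) 1 M] {c c' : WithTop ℕ∞} (hc : c' + 1 ≤ c)
    {e : OpenPartialHomeomorph M (EuclideanSpace ℝ (Fin k))}
    (he : e ∈ IsManifold.maximalAtlas (𝓡 k) c M) :
    ContMDiffOn 𝓘(ℝ, EuclideanSpace ℝ (Fin k) × EuclideanSpace ℝ (Fin k)) (𝓡 k).tangent c'
      (tangentOfCoords e) {z | z.1 ∈ e.target} := by
  have h1 := (contMDiffOn_symm_of_mem_maximalAtlas he).contMDiffOn_tangentMapWithin hc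
    e.open_target.uniqueMDiffOn
  have h2 := h1.comp (s := {z : EuclideanSpace ℝ (Fin k) × EuclideanSpace ℝ (Fin k) |
    z.1 ∈ e.target}) (contMDiff_mk_tangentBundle_modelSpace (k := k) (c := c')).contMDiffOn
    (fun z hz => hz)
  refine h2.congr fun z hz => ?_
  simp only [tangentOfCoords, Function.comp, tangentMapWithin]
  rw [mfderivWithin_of_isOpen e.open_target hz]
  rfl

end TangentCharts

/-! ### The Lagrangian of a Finsler spacetime in charts of the tangent bundle -/

namespace FinslerSpacetime

section

variable {m : ℕ} {M : Type*} [TopologicalSpace M]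

/-- The domain of the coordinate expression of the Lagrangian. -/
def slitDomain (e : OpenPartialHomeomorph M (EuclideanSpace ℝ (Fin (m + 1)))) :
    Set (EuclideanSpace ℝ (Fin (m + 1)) × EuclideanSpace ℝ (Fin (m + 1))) :=
  {z | z.1 ∈ e.target ∧ z.2 ≠ 0}

lemma isOpen_slitDomain (e : OpenPartialHomeomorph M (EuclideanSpace ℝ (Fin (m + 1)))) :
    IsOpen (slitDomain e) :=
  (e.open_target.preimage continuous_fst).inter (isOpen_ne.preimage continuous_snd)

variable [ChartedSpace (EuclideanSpace ℝ (Fin (m + 1))) M]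

lemma tangentOfCoords_coords {e : OpenPartialHomeomorph M (EuclideanSpace ℝ (Fin (m + 1)))}
    (he : e.MDifferentiable (𝓡 (m + 1)) (𝓡 (m + 1))) {v : TangentBundle (𝓡 (m + 1)) M}
    (hv : v.proj ∈ e.source) : tangentOfCoords e (coords e v) = v :=
  tangentBundle_mk_congr (e.left_inv hv) (chartSymmDeriv_chartDeriv he hv v.2)

lemma coords_tangentOfCoords {e : OpenPartialHomeomorph M (EuclideanSpace ℝ (Fin (m + 1)))}
    (he : e.MDifferentiable (𝓡 (m + 1)) (𝓡 (m + 1)))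
    {z : EuclideanSpace ℝ (Fin (m + 1)) × EuclideanSpace ℝ (Fin (m + 1))}
    (hz : z.1 ∈ e.target) : coords e (tangentOfCoords e z) = z :=
  Prod.ext (e.right_inv hz) (chartDeriv_chartSymmDeriv he hz z.2)

lemma chartDeriv_ne_zero {e : OpenPartialHomeomorph M (EuclideanSpace ℝ (Fin (m + 1)))}
    (he : e.MDifferentiable (𝓡 (m + 1)) (𝓡 (m + 1))) {p : M} (hp : p ∈ e.source)
    {w : EuclideanSpace ℝ (Fin (m + 1))} (hw : w ≠ 0) : chartDeriv e p w ≠ 0 := fun h0 => by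
  apply hw
  rw [← chartSymmDeriv_chartDeriv he hp w, h0, map_zero]

lemma coords_mem_slitDomain {e : OpenPartialHomeomorph M (EuclideanSpace ℝ (Fin (m + 1)))}
    (he : e.MDifferentiable (𝓡 (m + 1)) (𝓡 (m + 1))) {v : TangentBundle (𝓡 (m + 1)) M}
    (hv : v.proj ∈ e.source) (hv0 : v.2 ≠ 0) : coords e v ∈ slitDomain e :=
  ⟨e.map_source hv, chartDeriv_ne_zero he hv hv0⟩

lemma chartSymmDeriv_ne_zero {e : OpenPartialHomeomorph M (EuclideanSpace ℝ (Fin (m + 1)))}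
    (he : e.MDifferentiable (𝓡 (m + 1)) (𝓡 (m + 1)))
    {z : EuclideanSpace ℝ (Fin (m + 1)) × EuclideanSpace ℝ (Fin (m + 1))}
    (hz : z ∈ slitDomain e) : chartSymmDeriv e z.1 z.2 ≠ 0 := fun h0 => by
  apply hz.2
  rw [← chartDeriv_chartSymmDeriv he hz.1 z.2, h0, map_zero]

end

section

variable {m : ℕ} {M : Type*} [TopologicalSpace M]
  [ChartedSpace (EuclideanSpace ℝ (Fin (m + 1))) M]
  [IsManifold (𝓡 (m + 1)) ∞ M] (F : FinslerSpacetime m M)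
  {e : OpenPartialHomeomorph M (EuclideanSpace ℝ (Fin (m + 1)))}

lemma contDiffAt_lagrangianIn (he : e ∈ IsManifold.maximalAtlas (𝓡 (m + 1)) ∞ M)
    {z : EuclideanSpace ℝ (Fin (m + 1)) × EuclideanSpace ℝ (Fin (m + 1))}
    (hz : z ∈ slitDomain e) : ContDiffAt ℝ ∞ (F.lagrangianIn e) z := by
  have hd := mdifferentiable_of_mem_maximalAtlas (by simp) he
  have : IsManifold (𝓡 (m + 1)) 1 M := IsManifold.of_le (n := ∞) ENat.LEInfty.out
  have h1 := F.smooth.comp ((contMDiffOn_tangentOfCoords (c' := ∞) (by simp) he).mono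
    (fun z (hz : z ∈ slitDomain e) => hz.1))
    (fun z hz => chartSymmDeriv_ne_zero hd hz)
  exact (h1.contDiffOn z hz).contDiffAt ((isOpen_slitDomain e).mem_nhds hz)

lemma L_eq_lagrangianIn (he : e.MDifferentiable (𝓡 (m + 1)) (𝓡 (m + 1))) {p : M}
    (hp : p ∈ e.source) (w : EuclideanSpace ℝ (Fin (m + 1))) :
    F.L ⟨p, w⟩ = F.lagrangianIn e (e p, chartDeriv e p w) :=
  congrArg F.L (tangentOfCoords_coords he (v := ⟨p, w⟩) hp).symm

/-- The vertical Hessian in coordinates. -/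
lemma verticalHessian_eq (he : e ∈ IsManifold.maximalAtlas (𝓡 (m + 1)) ∞ M) {p : M}
    (hp : p ∈ e.source) {v : EuclideanSpace ℝ (Fin (m + 1))} (hv0 : v ≠ 0)
    (X Y : EuclideanSpace ℝ (Fin (m + 1))) :
    verticalHessian F.L ⟨p, v⟩ X Y =
      fderiv ℝ (fderiv ℝ (F.lagrangianIn e)) (e p, chartDeriv e p v)
        (0, chartDeriv e p X) (0, chartDeriv e p Y) := by
  have hd := mdifferentiable_of_mem_maximalAtlas (by simp) he
  have hP : ∀ u, HasFDerivAt (fun w : EuclideanSpace ℝ (Fin (m + 1)) => (e p, chartDeriv e p w))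
      ((0 : _ →L[ℝ] _).prod (chartDeriv e p)) u := fun u =>
    (hasFDerivAt_const (𝕜 := ℝ) (e p) u).prodMk (chartDeriv e p).hasFDerivAt
  have hmem : ∀ u : EuclideanSpace ℝ (Fin (m + 1)), u ≠ 0 →
      (e p, chartDeriv e p u) ∈ slitDomain e := fun u hu =>
    ⟨e.map_source hp, chartDeriv_ne_zero hd hp hu⟩
  have e1 : (fun w : EuclideanSpace ℝ (Fin (m + 1)) => F.L ⟨p, w⟩) =
      fun w => F.lagrangianIn e (e p, chartDeriv e p w) := funext fun w =>
    F.L_eq_lagrangianIn hd hp w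
  have h1 : ∀ u : EuclideanSpace ℝ (Fin (m + 1)), u ≠ 0 →
      fderiv ℝ (fun w => F.lagrangianIn e (e p, chartDeriv e p w)) u Y =
        fderiv ℝ (F.lagrangianIn e) (e p, chartDeriv e p u) (0, chartDeriv e p Y) := by
    intro u hu
    have e2 : HasFDerivAt (fun w => F.lagrangianIn e (e p, chartDeriv e p w)) _ u :=
      HasFDerivAt.comp u (g := F.lagrangianIn e) (f := fun w => (e p, chartDeriv e p w))
        ((F.contDiffAt_lagrangianIn he (hmem u hu)).differentiableAt
        (by simp)).hasFDerivAt (hP u)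
    rw [e2.fderiv]
    rfl
  have h2 : (fun u => fderiv ℝ (fun w => F.lagrangianIn e (e p, chartDeriv e p w)) u Y) =ᶠ[nhds v]
        fun u => fderiv ℝ (F.lagrangianIn e) (e p, chartDeriv e p u) (0, chartDeriv e p Y) := by
    filter_upwards [isOpen_ne.mem_nhds hv0] with u hu using h1 u hu
  have h3 : HasFDerivAt (fun u : EuclideanSpace ℝ (Fin (m + 1)) =>
      fderiv ℝ (F.lagrangianIn e) (e p, chartDeriv e p u) (0, chartDeriv e p Y)) _ v :=
    HasFDerivAt.comp (g := fun y => fderiv ℝ (F.lagrangianIn e) y (0, chartDeriv e p Y)) v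
      (LocalFinsler.hasFDerivAt_fderiv_apply (F.contDiffAt_lagrangianIn he (hmem v hv0))
        (hasFDerivAt_const _ _)) (hP v)
  have h4 : verticalHessian F.L ⟨p, v⟩ X Y = fderiv ℝ (fun u =>
      fderiv ℝ (fun w => F.lagrangianIn e (e p, chartDeriv e p w)) u Y) v X := by
    rw [← e1]
    rfl
  rw [h4, h2.fderiv_eq, h3.fderiv]
  simp

/-- The coordinate expression of the Lagrangian of a Finsler spacetime. -/
lemma isLagrangianOn_lagrangianIn (he : e ∈ IsManifold.maximalAtlas (𝓡 (m + 1)) ∞ M) :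
    LocalFinsler.IsLagrangianOn (F.lagrangianIn e) (slitDomain e) where
  isOpen := isOpen_slitDomain e
  isConic := fun z hz s hs => ⟨hz.1, smul_ne_zero hs.ne' hz.2⟩
  smooth := fun z hz => F.contDiffAt_lagrangianIn he hz
  homog := fun z hz s hs => by
    have hd := mdifferentiable_of_mem_maximalAtlas (by simp) he
    have h1 := F.homogeneous (e.symm z.1) (chartSymmDeriv e z.1 z.2) s
      (chartSymmDeriv_ne_zero hd hz) hs
    have h2 : chartSymmDeriv e z.1 (s • z.2) = s • chartSymmDeriv e z.1 z.2 := map_smul _ _ _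
    exact (congrArg (fun w : EuclideanSpace ℝ (Fin (m + 1)) => F.L ⟨e.symm z.1, w⟩) h2).trans h1
  isUnit_det := fun z hz => by
    have hd := mdifferentiable_of_mem_maximalAtlas (by simp) he
    rw [isUnit_iff_ne_zero]
    intro hdet
    -- A kernel vector of the coordinate Hessian is carried back to the tangent space, where pairing
    -- with the orthonormal basis `b` kills all its coordinates.
    obtain ⟨x, hx0, hx⟩ := Matrix.exists_mulVec_eq_zero_iff.2 hdet
    have hps : e.symm z.1 ∈ e.source := e.map_target hz.1
    have hv0 := chartSymmDeriv_ne_zero hd hz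
    have hsm := F.contDiffAt_lagrangianIn he hz
    have h1 : ∀ W, fderiv ℝ (fderiv ℝ (F.lagrangianIn e)) z (0, W) (0, WithLp.toLp 2 x) = 0 := by
      have hi : ∀ i, fderiv ℝ (fderiv ℝ (F.lagrangianIn e)) z (0, LocalFinsler.basisVec i)
          (0, WithLp.toLp 2 x) = 0 := by
        intro i
        have := congrFun hx i
        rw [LocalFinsler.IsLagrangianOn.map_inr_eq_sum]
        rw [Matrix.mulVec, dotProduct, Pi.zero_apply] at this
        rw [← this]
        refine Finset.sum_congr rfl fun j _ => ?_
        rw [smul_eq_mul, mul_comm]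
        congr 1
        exact (LocalFinsler.fderiv_fderiv_apply_const hsm _ _).symm
      intro W
      have := LocalFinsler.IsLagrangianOn.map_inr_eq_sum
        ((fderiv ℝ (fderiv ℝ (F.lagrangianIn e)) z).flip (0, WithLp.toLp 2 x)) W
      simpa [hi] using this
    obtain ⟨b, hb⟩ := F.lorentzian (tangentOfCoords e z) hv0
    set u := chartSymmDeriv e z.1 (WithLp.toLp 2 x) with hu
    have hAu : chartDeriv e (e.symm z.1) u = WithLp.toLp 2 x :=
      chartDeriv_chartSymmDeriv hd hz.1 _
    let B : EuclideanSpace ℝ (Fin (m + 1)) → EuclideanSpace ℝ (Fin (m + 1)) →L[ℝ] ℝ := fun X =>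
      ((fderiv ℝ (fderiv ℝ (F.lagrangianIn e)) z (0, chartDeriv e (e.symm z.1) X)).comp
          (ContinuousLinearMap.inr ℝ _ _)).comp (chartDeriv e (e.symm z.1))
    have hB : ∀ X Y, verticalHessian F.L (tangentOfCoords e z) X Y = B X Y := fun X Y => by
      rw [tangentOfCoords, F.verticalHessian_eq he hps hv0, e.right_inv hz.1,
        chartDeriv_chartSymmDeriv hd hz.1]
      rfl
    have hBu : ∀ X, B X u = 0 := fun X => by
      have : B X u = fderiv ℝ (fderiv ℝ (F.lagrangianIn e)) z (0, chartDeriv e (e.symm z.1) X)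
          (0, chartDeriv e (e.symm z.1) u) := rfl
      rw [this, hAu, h1]
    have hrep : ∀ i, b.repr u i = 0 := fun i => by
      have h2 : ∑ j, b.repr u j * B (b i) (b j) = 0 := by
        rw [← hBu (b i)]
        conv_rhs => rw [← b.sum_repr u, map_sum]
        exact Finset.sum_congr rfl fun j _ => (map_smul (B (b i)) _ _).symm
      simp only [← hB, hb] at h2
      simp only [mul_ite, mul_zero, Finset.sum_ite_eq, Finset.mem_univ, if_true] at h2
      split_ifs at h2 <;> simpa using h2
    have hu0 : u = 0 := by
      rw [← b.sum_repr u]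
      simp [hrep]
    rw [hu0, map_zero] at hAu
    exact hx0 (congrArg WithLp.ofLp hAu.symm)

end

end FinslerSpacetime

/-! ### The negative locus of a function near a regular zero -/

open Filter Topology

/-- Near a regular point of its zero set, the negative locus of `f` is connected, and the zero set
lies in its closure. -/
lemma exists_nhds_joined_neg {E : Type*} [NormedAddCommGroup E] [NormedSpace ℝ E] {f : E → ℝ}
    {U : Set E} {x₀ w : E} (hU : IsOpen U) (hx₀ : x₀ ∈ U) (hf : ∀ x ∈ U, ContDiffAt ℝ 1 f x)
    (h0 : f x₀ = 0) (hw : fderiv ℝ f x₀ w < 0) :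
    ∃ B ∈ 𝓝 x₀, B ⊆ U ∧
      (∀ a ∈ B, ∀ b ∈ B, f a < 0 → f b < 0 →
        ∃ S ⊆ U ∩ {x | f x < 0}, IsPreconnected S ∧ a ∈ S ∧ b ∈ S) ∧
      (∀ a ∈ B, f a = 0 → a ∈ closure (B ∩ {x | f x < 0})) := by
  have hcont : ContinuousAt (fun x => fderiv ℝ f x w) x₀ :=
    (((hf x₀ hx₀).fderiv_right (m := 0) (by simp)).continuousAt).clm_apply continuousAt_const
  obtain ⟨r, hr, hrU⟩ := Metric.mem_nhds_iff.1
    (inter_mem (hU.mem_nhds hx₀) (hcont.eventually (gt_mem_nhds hw)))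
  have hdiff : ∀ x ∈ Metric.ball x₀ r, DifferentiableAt ℝ f x := fun x hx =>
    (hf x (hrU hx).1).differentiableAt (by simp)
  have hdec : ∀ a : E, ∀ t : ℝ, (∀ s ∈ Set.Icc 0 t, a + s • w ∈ Metric.ball x₀ r) →
      StrictAntiOn (fun s : ℝ => f (a + s • w)) (Set.Icc 0 t) := by
    intro a t ht
    have hder : ∀ s ∈ Set.Icc 0 t,
        HasDerivAt (fun s : ℝ => f (a + s • w)) (fderiv ℝ f (a + s • w) w) s := by
      intro s hs
      have h1 : HasDerivAt (fun s : ℝ => a + s • w) w s := by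
        simpa using ((hasDerivAt_id s).smul_const w).const_add a
      exact (hdiff _ (ht s hs)).hasFDerivAt.comp_hasDerivAt s h1
    refine strictAntiOn_of_deriv_neg (convex_Icc 0 t)
      (fun s hs => (hder s hs).continuousAt.continuousWithinAt) fun s hs => ?_
    have hs' := interior_subset hs
    rw [(hder s hs').deriv]
    exact (hrU (ht s hs')).2
  -- Chosen so that moving by s w with s ≤ t covers less than r/2; the added 1 keeps the denominator
  -- positive without appeal to w ≠ 0.
  set t : ℝ := r / (2 * (‖w‖ + 1)) with ht_def
  have hwpos : 0 < ‖w‖ + 1 := by positivity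
  have ht : 0 < t := by positivity
  have htw : ∀ s ∈ Set.Icc 0 t, ‖s • w‖ < r / 2 := by
    intro s hs
    rw [norm_smul, Real.norm_of_nonneg hs.1]
    calc s * ‖w‖ ≤ t * ‖w‖ := by gcongr; exact hs.2
      _ < t * (‖w‖ + 1) := by gcongr; linarith
      _ = r / 2 := by rw [ht_def]; field_simp
  have hball : ∀ a ∈ Metric.ball x₀ (r / 2), ∀ s ∈ Set.Icc 0 t, a + s • w ∈ Metric.ball x₀ r := by
    intro a ha s hs
    rw [Metric.mem_ball, dist_eq_norm] at ha ⊢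
    calc ‖a + s • w - x₀‖ = ‖(a - x₀) + s • w‖ := by congr 1; abel
      _ ≤ ‖a - x₀‖ + ‖s • w‖ := norm_add_le _ _
      _ < r := by linarith [htw s hs]
  have hneg : f (x₀ + t • w) < 0 := by
    have := hdec x₀ t (hball x₀ (Metric.mem_ball_self (by positivity)))
      (Set.left_mem_Icc.2 ht.le) (Set.right_mem_Icc.2 ht.le) ht
    simpa [h0] using this
  have hcont' : ContinuousAt (fun a => f (a + t • w)) x₀ := by
    refine ContinuousAt.comp (g := f) ?_ (by fun_prop)
    exact (hdiff _ (hball x₀ (Metric.mem_ball_self (by positivity)) t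
      (Set.right_mem_Icc.2 ht.le))).continuousAt
  obtain ⟨δ, hδ, hδt⟩ := Metric.mem_nhds_iff.1 (inter_mem
    (Metric.ball_mem_nhds x₀ (half_pos hr)) (hcont'.eventually (gt_mem_nhds hneg)))
  have hle : ∀ a ∈ Metric.ball x₀ δ, f a < 0 → ∀ x ∈ segment ℝ a (a + t • w),
      x ∈ U ∩ {x | f x < 0} := by
    intro a ha hfa x hx
    rw [segment_eq_image'] at hx
    obtain ⟨θ, hθ, rfl⟩ := hx
    have hs : θ * t ∈ Set.Icc 0 t :=
      ⟨mul_nonneg hθ.1 ht.le, mul_le_of_le_one_left ht.le hθ.2⟩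
    have e1 : a + θ • (a + t • w - a) = a + (θ * t) • w := by
      rw [add_sub_cancel_left, smul_smul]
    simp only [e1]
    have hb := hball a (hδt ha).1
    refine ⟨(hrU (hb _ hs)).1, ?_⟩
    have := (hdec a t hb).antitoneOn (Set.left_mem_Icc.2 ht.le) hs hs.1
    simp only [zero_smul, add_zero] at this
    exact this.trans_lt hfa
  refine ⟨Metric.ball x₀ δ, Metric.ball_mem_nhds _ hδ, fun a ha => ?_, ?_, ?_⟩
  · have := hball a (hδt ha).1 0 (Set.left_mem_Icc.2 ht.le)
    rw [zero_smul, add_zero] at this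
    exact (hrU this).1
  · intro a ha b hb hfa hfb
    -- Both points are pushed along w, where f decreases, and joined at the far end: there the whole
    -- translated ball lies in f < 0.
    refine ⟨segment ℝ a (a + t • w) ∪ segment ℝ (a + t • w) (b + t • w) ∪
      segment ℝ b (b + t • w), ?_, ?_, ?_, ?_⟩
    · rintro x ((hx | hx) | hx)
      · exact hle a ha hfa x hx
      · rw [add_comm a, add_comm b, ← segment_translate_image ℝ (t • w) a b] at hx
        obtain ⟨c, hc, rfl⟩ := hx
        have hcB : c ∈ Metric.ball x₀ δ := (convex_ball x₀ δ).segment_subset ha hb hc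
        simp only [add_comm (t • w) c]
        exact ⟨(hrU (hball c (hδt hcB).1 t (Set.right_mem_Icc.2 ht.le))).1, (hδt hcB).2⟩
      · exact hle b hb hfb x hx
    · refine IsPreconnected.union (b + t • w) (Or.inr (right_mem_segment ℝ _ _))
        (right_mem_segment ℝ _ _) ?_ (convex_segment _ _).isPreconnected
      exact IsPreconnected.union (a + t • w) (right_mem_segment ℝ _ _) (left_mem_segment ℝ _ _)
        (convex_segment _ _).isPreconnected (convex_segment _ _).isPreconnected
    · exact Or.inl (Or.inl (left_mem_segment ℝ _ _))
    · exact Or.inr (left_mem_segment ℝ _ _)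
  · intro a ha hfa
    have hlim : Tendsto (fun s : ℝ => a + s • w) (𝓝[>] 0) (𝓝 a) := by
      have : ContinuousAt (fun s : ℝ => a + s • w) 0 := by fun_prop
      have := this.tendsto.mono_left (nhdsWithin_le_nhds (s := Set.Ioi 0))
      simpa using this
    refine mem_closure_of_tendsto hlim ?_
    filter_upwards [hlim.eventually (Metric.isOpen_ball.mem_nhds ha), Ioc_mem_nhdsGT ht]
      with s hs hst
    refine ⟨hs, ?_⟩
    have := hdec a t (hball a (hδt ha).1) (Set.left_mem_Icc.2 ht.le) ⟨hst.1.le, hst.2⟩ hst.1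
    simp only [zero_smul, add_zero, hfa] at this
    exact this

section TangentCharts

variable {k : ℕ} {M : Type*} [TopologicalSpace M] [ChartedSpace (EuclideanSpace ℝ (Fin k)) M]

/-- Tangent coordinates cost one derivative: nothing is lost on M, and a C² chart of H still gives
C¹ components of n. -/
lemma contMDiffOn_chartDeriv [IsManifold (𝓡 k) 1 M] {c c' : WithTop ℕ∞} (hc : c' + 1 ≤ c)
    {e : OpenPartialHomeomorph M (EuclideanSpace ℝ (Fin k))}
    (he : e ∈ IsManifold.maximalAtlas (𝓡 k) c M) :
    ContMDiffOn (𝓡 k).tangent 𝓘(ℝ, EuclideanSpace ℝ (Fin k)) c'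
      (fun v : TangentBundle (𝓡 k) M => chartDeriv e v.proj v.2) {v | v.proj ∈ e.source} := by
  have h1 := (contMDiffOn_of_mem_maximalAtlas he).contMDiffOn_tangentMapWithin hc
    e.open_source.uniqueMDiffOn
  refine ((contMDiff_snd_tangentBundle_modelSpace (EuclideanSpace ℝ (Fin k))
    (𝓡 k)).comp_contMDiffOn h1).congr fun v hv => ?_
  simp only [Function.comp, tangentMapWithin]
  rw [mfderivWithin_of_isOpen e.open_source hv]
  rfl

end TangentCharts

/-! ### The future light cone and minima of the Ricci scalar -/

namespace FinslerSpacetime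

section

variable {m : ℕ} {M : Type*} [TopologicalSpace M]
  [ChartedSpace (EuclideanSpace ℝ (Fin (m + 1))) M]
  [IsManifold (𝓡 (m + 1)) ∞ M] (F : FinslerSpacetime m M)
  {e : OpenPartialHomeomorph M (EuclideanSpace ℝ (Fin (m + 1)))}

lemma continuousAt_coords (he : e ∈ IsManifold.maximalAtlas (𝓡 (m + 1)) ∞ M)
    {v : TangentBundle (𝓡 (m + 1)) M} (hv : v.proj ∈ e.source) : ContinuousAt (coords e) v := by
  have : IsManifold (𝓡 (m + 1)) 1 M := IsManifold.of_le (n := ∞) ENat.LEInfty.out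
  have hp : Continuous (Bundle.TotalSpace.proj : TangentBundle (𝓡 (m + 1)) M → M) :=
    FiberBundle.continuous_proj _ _
  have h1 : ContinuousAt (fun v : TangentBundle (𝓡 (m + 1)) M => e v.proj) v :=
    ContinuousAt.comp (g := e) (e.continuousAt hv) hp.continuousAt
  exact h1.prodMk ((contMDiffOn_chartDeriv (c' := ∞) (by simp) he).continuousOn.continuousAt
    ((e.open_source.preimage hp).mem_nhds hv))

/-- Near a future-directed lightlike vector, the null vectors are future-directed. -/
lemma eventually_mem_futureLightCone (he : e ∈ IsManifold.maximalAtlas (𝓡 (m + 1)) ∞ M)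
    {v : TangentBundle (𝓡 (m + 1)) M} (hv : v ∈ F.futureLightCone) (hvs : v.proj ∈ e.source)
    (h0 : F.lagrangianIn e (coords e v) = 0) :
    ∀ᶠ z in 𝓝 (coords e v), F.lagrangianIn e z = 0 →
      tangentOfCoords e z ∈ F.futureLightCone := by
  have : IsManifold (𝓡 (m + 1)) 1 M := IsManifold.of_le (n := ∞) ENat.LEInfty.out
  have hd := mdifferentiable_of_mem_maximalAtlas (by simp) he
  have hL := F.isLagrangianOn_lagrangianIn he
  have hz := coords_mem_slitDomain hd hvs hv.1
  obtain ⟨ξ, hξ⟩ := hL.exists_fderiv_eq_one hz hz.2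
  obtain ⟨B, hB, hBU, hjoin, hclos⟩ := exists_nhds_joined_neg (w := -(0, ξ)) hL.isOpen hz
    (fun x hx => (hL.smooth x hx).of_le ENat.LEInfty.out) h0
    (by rw [map_neg, hξ]; norm_num)
  obtain ⟨v₀, hv₀, hC⟩ := F.isComponent
  have hp : Continuous (Bundle.TotalSpace.proj : TangentBundle (𝓡 (m + 1)) M → M) :=
    FiberBundle.continuous_proj _ _
  have hcont : ContinuousOn (tangentOfCoords e) {z | z.1 ∈ e.target} :=
    (contMDiffOn_tangentOfCoords (c' := ∞) (by simp) he).continuousOn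
  -- A future timelike vector u close to v. Every nearby vector with L < 0 can be joined to u inside
  -- L < 0, hence belongs to the same component.
  obtain ⟨u, ⟨huB, hus⟩, huC⟩ := mem_closure_iff_nhds.1 (frontier_subset_closure hv.2) _
    (inter_mem (continuousAt_coords he hvs hB) ((e.open_source.preimage hp).mem_nhds hvs))
  have huneg : F.lagrangianIn e (coords e u) < 0 := by
    have h1 : u ∈ {v : TangentBundle (𝓡 (m + 1)) M | v.2 ≠ 0 ∧ F.L v < 0} :=
      connectedComponentIn_subset _ _ (hC ▸ huC)
    have h2 : F.lagrangianIn e (coords e u) = F.L u :=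
      congrArg F.L (tangentOfCoords_coords hd hus)
    rw [h2]
    exact h1.2
  have hmem : ∀ a ∈ B, F.lagrangianIn e a < 0 → tangentOfCoords e a ∈ F.futureTimelike := by
    intro a ha han
    obtain ⟨S, hS, hSc, haS, huS⟩ := hjoin a ha _ huB han huneg
    have h1 : IsPreconnected (tangentOfCoords e '' S) :=
      hSc.image _ (hcont.mono fun x hx => (hS hx).1.1)
    have h2 : tangentOfCoords e '' S ⊆
        {v : TangentBundle (𝓡 (m + 1)) M | v.2 ≠ 0 ∧ F.L v < 0} := by
      rintro _ ⟨x, hx, rfl⟩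
      exact ⟨chartSymmDeriv_ne_zero hd (hS hx).1, (hS hx).2⟩
    have h3 : u ∈ tangentOfCoords e '' S := ⟨_, huS, tangentOfCoords_coords hd hus⟩
    rw [hC, connectedComponentIn_eq (hC ▸ huC)]
    exact h1.subset_connectedComponentIn h3 h2 ⟨a, haS, rfl⟩
  filter_upwards [hB] with z hzB hz0
  refine ⟨chartSymmDeriv_ne_zero hd (hBU hzB), ?_, ?_⟩
  · have hca : ContinuousAt (tangentOfCoords e) z :=
      hcont.continuousAt ((e.open_target.preimage continuous_fst).mem_nhds (hBU hzB).1)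
    exact hca.continuousWithinAt.mem_closure (hclos z hzB hz0) fun x hx => hmem x hx.1 hx.2
  · intro hint
    have h1 : tangentOfCoords e z ∈ {v : TangentBundle (𝓡 (m + 1)) M | v.2 ≠ 0 ∧ F.L v < 0} :=
      connectedComponentIn_subset _ _ (hC ▸ interior_subset hint)
    have h2 : F.L (tangentOfCoords e z) = 0 := hz0
    exact (h2 ▸ h1.2).false

/-- If the Ricci scalar is nonnegative on the future light cone and vanishes at `v`, its vertical
derivative at `v` vanishes on the vectors orthogonal to `v`. -/
lemma dv_ricciScalar_eq_zero (he : e ∈ IsManifold.maximalAtlas (𝓡 (m + 1)) ∞ M)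
    (hnc : F.NullConvergence) {v : TangentBundle (𝓡 (m + 1)) M} (hv : v ∈ F.futureLightCone)
    (hvs : v.proj ∈ e.source) (h0 : F.lagrangianIn e (coords e v) = 0)
    (hR : LocalFinsler.ricciScalar (F.lagrangianIn e) (coords e v) = 0)
    {Y : EuclideanSpace ℝ (Fin (m + 1))}
    (hY : fderiv ℝ (F.lagrangianIn e) (coords e v) (0, Y) = 0) :
    LocalFinsler.dv (LocalFinsler.ricciScalar (F.lagrangianIn e)) (coords e v) Y = 0 := by
  have hd := mdifferentiable_of_mem_maximalAtlas (by simp) he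
  have hL := F.isLagrangianOn_lagrangianIn he
  have hz := coords_mem_slitDomain hd hvs hv.1
  set z := coords e v with hzdef
  have hP : HasStrictFDerivAt (fun w : EuclideanSpace ℝ (Fin (m + 1)) => (z.1, w))
      (ContinuousLinearMap.inr ℝ _ _) z.2 :=
    (hasStrictFDerivAt_const (𝕜 := ℝ) z.1 z.2).prodMk (hasStrictFDerivAt_id z.2)
  have hℓ : HasStrictFDerivAt (fun w => F.lagrangianIn e (z.1, w))
      ((fderiv ℝ (F.lagrangianIn e) z).comp (ContinuousLinearMap.inr ℝ _ _)) z.2 :=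
    HasStrictFDerivAt.comp z.2 (g := F.lagrangianIn e)
      ((hL.smooth z hz).hasStrictFDerivAt (by simp)) hP
  have hRic : HasStrictFDerivAt (fun w => LocalFinsler.ricciScalar (F.lagrangianIn e) (z.1, w))
      ((fderiv ℝ (LocalFinsler.ricciScalar (F.lagrangianIn e)) z).comp
        (ContinuousLinearMap.inr ℝ _ _)) z.2 :=
    HasStrictFDerivAt.comp z.2 (g := LocalFinsler.ricciScalar (F.lagrangianIn e))
      ((hL.contDiffAt_ricciScalar hz).hasStrictFDerivAt (by simp)) hP
  have hmin : IsLocalExtrOn (fun w => LocalFinsler.ricciScalar (F.lagrangianIn e) (z.1, w))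
      {w | F.lagrangianIn e (z.1, w) = F.lagrangianIn e (z.1, z.2)} z.2 := by
    -- Only the fibre variable moves, the base point being fixed; nearby null vectors are
    -- future-directed, so null convergence bounds Ric below by its value 0 at v.
    refine Or.inl ?_
    have hev : ∀ᶠ w in 𝓝 z.2, F.lagrangianIn e (z.1, w) = 0 →
        tangentOfCoords e (z.1, w) ∈ F.futureLightCone :=
      hP.continuousAt.eventually (F.eventually_mem_futureLightCone he hv hvs h0)
    filter_upwards [nhdsWithin_le_nhds hev, self_mem_nhdsWithin] with w hw hw'
    have hw0 : F.lagrangianIn e (z.1, w) = 0 := hw'.trans h0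
    have h1 := hnc e he _ (hw hw0) (e.map_target hz.1)
    rw [coords_tangentOfCoords hd (z := (z.1, w)) hz.1] at h1
    rw [show LocalFinsler.ricciScalar (F.lagrangianIn e) (z.1, z.2) = 0 from hR]
    exact h1
  obtain ⟨a, b, hab, hsum⟩ := hmin.exists_multipliers_of_hasStrictFDerivAt_1d hℓ hRic
  have hsum' : ∀ W, a * fderiv ℝ (F.lagrangianIn e) z (0, W) +
      b * fderiv ℝ (LocalFinsler.ricciScalar (F.lagrangianIn e)) z (0, W) = 0 := fun W =>
    congrArg (fun T => T W) hsum
  -- The constraint is regular: if b = 0, evaluating on ξ with dL(ξ) = 1 forces a = 0 too.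
  have hb : b ≠ 0 := by
    rintro rfl
    obtain ⟨ξ, hξ⟩ := hL.exists_fderiv_eq_one hz hz.2
    have := hsum' ξ
    rw [hξ] at this
    apply hab
    simpa using this
  have := hsum' Y
  rw [hY, mul_zero, zero_add] at this
  exact (mul_eq_zero.1 this).resolve_left hb

end

/-! ### The field equations and the vanishing of the Ricci 1-form -/

section

variable {m : ℕ} {M : Type*} [TopologicalSpace M]
  [ChartedSpace (EuclideanSpace ℝ (Fin (m + 1))) M]
  [IsManifold (𝓡 (m + 1)) ∞ M] {F : FinslerSpacetime m M}
  {e : OpenPartialHomeomorph M (EuclideanSpace ℝ (Fin (m + 1)))}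
  {H : Type*} [TopologicalSpace H] [ChartedSpace (EuclideanSpace ℝ (Fin m)) H]
  {ι : H → M} {n : ∀ p : H, TangentSpace (𝓡 m) p}

lemma ricciGradientEq_iff_chiVanishes (F : FinslerSpacetime m M) :
    F.RicciGradientEq ↔ F.ChiVanishes := by
  refine forall₅_congr fun e he v hv hvs => forall_congr' fun a => ?_
  rw [(F.isLagrangianOn_lagrangianIn he).dv_ricciScalar
    (coords_mem_slitDomain (mdifferentiable_of_mem_maximalAtlas (by simp) he) hvs hv)]
  exact add_eq_left

/-- The tangent space of a null hypersurface, in coordinates. -/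
lemma IsNullHypersurface.fderiv_eq_zero_iff (hH : F.IsNullHypersurface ι n)
    (he : e ∈ IsManifold.maximalAtlas (𝓡 (m + 1)) ∞ M) {p : H} (hp : ι p ∈ e.source)
    (W : EuclideanSpace ℝ (Fin (m + 1))) :
    fderiv ℝ (F.lagrangianIn e) (coords e (push ι p (n p))) (0, W) = 0 ↔
      ∃ X : TangentSpace (𝓡 m) p, components e (push ι p X) = W := by
  have hd := mdifferentiable_of_mem_maximalAtlas (by simp) he
  have hL := F.isLagrangianOn_lagrangianIn he
  have hz := coords_mem_slitDomain hd (v := push ι p (n p)) hp (hH.lightlike p).1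
  let nv : EuclideanSpace ℝ (Fin (m + 1)) := mfderiv (𝓡 m) (𝓡 (m + 1)) ι p (n p)
  let W' : EuclideanSpace ℝ (Fin (m + 1)) := chartSymmDeriv e (e (ι p)) W
  have hW' : chartDeriv e (ι p) W' = W := by
    have := chartDeriv_chartSymmDeriv hd (e.map_source hp) W
    rwa [e.left_inv hp] at this
  have h1 : fderiv ℝ (F.lagrangianIn e) (coords e (push ι p (n p))) (0, W) =
      verticalHessian F.L (push ι p (n p)) nv W' := by
    have h2 := F.verticalHessian_eq he hp (v := nv) (hH.lightlike p).1 nv W'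
    rw [hW'] at h2
    exact ((hL.metric_apply_fiber hz W).symm.trans
      (LocalFinsler.fderiv_fderiv_comm (F.contDiffAt_lagrangianIn he hz) _ _)).trans h2.symm
  rw [h1]
  refine (hH.ker_eq p W').trans ⟨?_, ?_⟩
  · rintro ⟨X, hX⟩
    refine ⟨X, ?_⟩
    rw [← hW', ← hX]
    rfl
  · rintro ⟨X, rfl⟩
    exact ⟨X, (chartSymmDeriv_chartDeriv hd hp _).symm⟩

/-- The vector n is tangent to H, so dL(n) = g_n(n, n) = 0, and Euler's identity reads dL(n) =
2L(n). -/
lemma IsNullHypersurface.lagrangianIn_eq_zero (hH : F.IsNullHypersurface ι n)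
    (he : e ∈ IsManifold.maximalAtlas (𝓡 (m + 1)) ∞ M) {p : H} (hp : ι p ∈ e.source) :
    F.lagrangianIn e (coords e (push ι p (n p))) = 0 := by
  have hd := mdifferentiable_of_mem_maximalAtlas (by simp) he
  have hz := coords_mem_slitDomain hd (v := push ι p (n p)) hp (hH.lightlike p).1
  have h1 := (F.isLagrangianOn_lagrangianIn he).euler hz
  have h2 := (hH.fderiv_eq_zero_iff he hp (components e (push ι p (n p)))).2 ⟨_, rfl⟩
  have h3 := h1.symm.trans h2
  linarith

/-- The main implication. -/
lemma IsNullHypersurface.ricciFormVanishes (hH : F.IsNullHypersurface ι n)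
    (hnc : F.NullConvergence) (hgrad : F.RicciGradientEq) (hR : F.RicciScalarVanishes ι n) :
    F.RicciFormVanishes ι n := by
  intro e he p hp Y
  have hd := mdifferentiable_of_mem_maximalAtlas (by simp) he
  have hL := F.isLagrangianOn_lagrangianIn he
  have hz := coords_mem_slitDomain hd (v := push ι p (n p)) hp (hH.lightlike p).1
  have h1 := F.dv_ricciScalar_eq_zero he hnc (hH.lightlike p) hp (hH.lagrangianIn_eq_zero he hp)
    (hR e he p hp) ((hH.fderiv_eq_zero_iff he hp _).2 ⟨Y, rfl⟩)
  have hform : ∀ W, LocalFinsler.dv (LocalFinsler.ricciScalar (F.lagrangianIn e))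
      (coords e (push ι p (n p))) W = 2 * LocalFinsler.ricciForm (F.lagrangianIn e)
        (coords e (push ι p (n p))) W := by
    intro W
    have hsum : LocalFinsler.ricciForm (F.lagrangianIn e) (coords e (push ι p (n p))) W =
        ∑ a, W a * LocalFinsler.ricciForm (F.lagrangianIn e) (coords e (push ι p (n p)))
          (LocalFinsler.basisVec a) := by
      simp only [LocalFinsler.ricciForm, Finset.mul_sum]
      rw [Finset.sum_comm]
      refine Finset.sum_congr rfl fun c _ => ?_
      rw [hL.curvature_eq_sum hz]
      simp
    rw [LocalFinsler.dv, LocalFinsler.IsLagrangianOn.map_inr_eq_sum, hsum, Finset.mul_sum]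
    refine Finset.sum_congr rfl fun a _ => ?_
    have := hgrad e he (push ι p (n p)) (hH.lightlike p).1 hp a
    rw [LocalFinsler.dv] at this
    rw [this, smul_eq_mul]
    ring
  rw [hform] at h1
  linarith

end

end FinslerSpacetime

/-! ### Hypersurfaces and their tangent fields in charts -/

namespace FinslerSpacetime

section

variable {m : ℕ} {M : Type*} [TopologicalSpace M] {H : Type*} [TopologicalSpace H]
  {e : OpenPartialHomeomorph M (EuclideanSpace ℝ (Fin (m + 1)))} {ι : H → M}
  {h : OpenPartialHomeomorph H (EuclideanSpace ℝ (Fin m))}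

/-- The expression of a map `ι` in charts. -/
def mapIn (e : OpenPartialHomeomorph M (EuclideanSpace ℝ (Fin (m + 1)))) (ι : H → M)
    (h : OpenPartialHomeomorph H (EuclideanSpace ℝ (Fin m))) (x : EuclideanSpace ℝ (Fin m)) :
    EuclideanSpace ℝ (Fin (m + 1)) :=
  e (ι (h.symm x))

/-- The domain of the expression of `ι` in charts. -/
def mapDomain (e : OpenPartialHomeomorph M (EuclideanSpace ℝ (Fin (m + 1)))) (ι : H → M)
    (h : OpenPartialHomeomorph H (EuclideanSpace ℝ (Fin m))) : Set (EuclideanSpace ℝ (Fin m)) :=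
  {x | x ∈ h.target ∧ ι (h.symm x) ∈ e.source}

lemma isOpen_mapDomain (hι : Continuous ι) : IsOpen (mapDomain e ι h) :=
  h.continuousOn_symm.isOpen_inter_preimage h.open_target (e.open_source.preimage hι)

lemma mem_mapDomain (hp : p ∈ h.source) (hpe : ι p ∈ e.source) : h p ∈ mapDomain e ι h :=
  ⟨h.map_source hp, by rwa [h.left_inv hp]⟩

end

section

variable {m : ℕ} {M : Type*} [TopologicalSpace M]
  [ChartedSpace (EuclideanSpace ℝ (Fin (m + 1))) M]
  {e : OpenPartialHomeomorph M (EuclideanSpace ℝ (Fin (m + 1)))}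
  {H : Type*} [TopologicalSpace H] [ChartedSpace (EuclideanSpace ℝ (Fin m)) H]
  {ι : H → M} {n : ∀ p : H, TangentSpace (𝓡 m) p}
  {h : OpenPartialHomeomorph H (EuclideanSpace ℝ (Fin m))} {x : EuclideanSpace ℝ (Fin m)}
  {p : H}

/-- The components in charts of the image under `ι` of the tangent field `n`. -/
def fieldIn (e : OpenPartialHomeomorph M (EuclideanSpace ℝ (Fin (m + 1)))) (ι : H → M)
    (n : ∀ p : H, TangentSpace (𝓡 m) p) (h : OpenPartialHomeomorph H (EuclideanSpace ℝ (Fin m)))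
    (x : EuclideanSpace ℝ (Fin m)) : EuclideanSpace ℝ (Fin (m + 1)) :=
  components e (push ι (h.symm x) (n (h.symm x)))

lemma contDiffAt_mapIn (he : e ∈ IsManifold.maximalAtlas (𝓡 (m + 1)) 2 M)
    (hh : h ∈ IsManifold.maximalAtlas (𝓡 m) 2 H) (hι : ContMDiff (𝓡 m) (𝓡 (m + 1)) 2 ι)
    (hx : x ∈ mapDomain e ι h) : ContDiffAt ℝ 2 (mapIn e ι h) x := by
  have h1 : ContMDiffAt (𝓡 m) (𝓡 (m + 1)) 2 (fun x => ι (h.symm x)) x :=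
    hι.contMDiffAt.comp x (contMDiffAt_symm_of_mem_maximalAtlas hh hx.1)
  exact (ContMDiffAt.comp x (g := e) (f := fun x => ι (h.symm x))
    (contMDiffAt_of_mem_maximalAtlas he hx.2) h1).contDiffAt

lemma fderiv_mapIn (he : e.MDifferentiable (𝓡 (m + 1)) (𝓡 (m + 1)))
    (hh : h.MDifferentiable (𝓡 m) (𝓡 m)) (hι : MDifferentiable (𝓡 m) (𝓡 (m + 1)) ι)
    (hx : x ∈ mapDomain e ι h) (X : EuclideanSpace ℝ (Fin m)) :
    fderiv ℝ (mapIn e ι h) x X = components e (push ι (h.symm x) (chartSymmDeriv h x X)) := by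
  have h1 := (hι (h.symm x)).hasMFDerivAt.comp x (hh.mdifferentiableAt_symm hx.1).hasMFDerivAt
  have h2 := HasMFDerivAt.comp x (g := e) (f := ι ∘ h.symm)
    (he.mdifferentiableAt hx.2).hasMFDerivAt h1
  let D : EuclideanSpace ℝ (Fin m) →L[ℝ] EuclideanSpace ℝ (Fin (m + 1)) :=
    mfderiv (𝓡 m) (𝓡 (m + 1)) ι (h.symm x)
  have h3 : HasFDerivAt (mapIn e ι h)
      ((chartDeriv e (ι (h.symm x))).comp (D.comp (chartSymmDeriv h x))) x :=
    hasMFDerivAt_iff_hasFDerivAt.1 h2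
  rw [h3.fderiv]
  rfl

lemma coords_push_eq (hp : p ∈ h.source) :
    (mapIn e ι h (h p), fieldIn e ι n h (h p)) = coords e (push ι p (n p)) :=
  congrArg (fun q => coords e (push ι q (n q))) (h.left_inv hp)

lemma fderiv_mapIn_chartDeriv (he : e.MDifferentiable (𝓡 (m + 1)) (𝓡 (m + 1)))
    (hh : h.MDifferentiable (𝓡 m) (𝓡 m)) (hι : MDifferentiable (𝓡 m) (𝓡 (m + 1)) ι)
    (hp : p ∈ h.source) (hpe : ι p ∈ e.source) (X : EuclideanSpace ℝ (Fin m)) :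
    fderiv ℝ (mapIn e ι h) (h p) (chartDeriv h p X) = components e (push ι p X) := by
  rw [fderiv_mapIn he hh hι (mem_mapDomain hp hpe), chartSymmDeriv_chartDeriv hh hp]
  exact congrArg (fun q => components e (push ι q X)) (h.left_inv hp)

lemma fderiv_mapIn_field (he : e.MDifferentiable (𝓡 (m + 1)) (𝓡 (m + 1)))
    (hh : h.MDifferentiable (𝓡 m) (𝓡 m)) (hι : MDifferentiable (𝓡 m) (𝓡 (m + 1)) ι)
    (hx : x ∈ mapDomain e ι h) :
    fderiv ℝ (mapIn e ι h) x (chartDeriv h (h.symm x) (n (h.symm x))) = fieldIn e ι n h x := by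
  rw [fderiv_mapIn he hh hι hx]
  have h1 := chartSymmDeriv_chartDeriv hh (h.map_target hx.1) (n (h.symm x))
  rw [h.right_inv hx.1] at h1
  rw [h1]
  rfl

/-- The field is the differential of the C² map `mapIn` applied to the C¹ components of n in the
chart of H. -/
lemma differentiableAt_fieldIn [IsManifold (𝓡 m) 1 H]
    (he : e ∈ IsManifold.maximalAtlas (𝓡 (m + 1)) 2 M)
    (hh : h ∈ IsManifold.maximalAtlas (𝓡 m) 2 H) (hι : ContMDiff (𝓡 m) (𝓡 (m + 1)) 2 ι)
    (hn : ContMDiff (𝓡 m) (𝓡 m).tangent 1 (fun p => (⟨p, n p⟩ : TangentBundle (𝓡 m) H)))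
    (hx : x ∈ mapDomain e ι h) : DifferentiableAt ℝ (fieldIn e ι n h) x := by
  have h1 : ContMDiffAt (𝓡 m) (𝓡 m).tangent 1
      (fun x => (⟨h.symm x, n (h.symm x)⟩ : TangentBundle (𝓡 m) H)) x :=
    ContMDiffAt.comp x (g := fun p => (⟨p, n p⟩ : TangentBundle (𝓡 m) H)) hn.contMDiffAt
      ((contMDiffAt_symm_of_mem_maximalAtlas hh hx.1).of_le (by norm_num))
  have hp : Continuous (Bundle.TotalSpace.proj : TangentBundle (𝓡 m) H → H) :=
    FiberBundle.continuous_proj _ _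
  have h2 : ContMDiffAt (𝓡 m) 𝓘(ℝ, EuclideanSpace ℝ (Fin m)) 1
      (fun x => chartDeriv h (h.symm x) (n (h.symm x))) x :=
    ContMDiffAt.comp x (g := fun v : TangentBundle (𝓡 m) H => chartDeriv h v.proj v.2)
      ((contMDiffOn_chartDeriv (c' := 1) (by norm_num) hh).contMDiffAt
        ((h.open_source.preimage hp).mem_nhds (h.map_target hx.1))) h1
  have h3 : DifferentiableAt ℝ (fun x => fderiv ℝ (mapIn e ι h) x
      (chartDeriv h (h.symm x) (n (h.symm x)))) x :=
    (((contDiffAt_mapIn he hh hι hx).fderiv_right (m := 1) (by norm_num)).differentiableAt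
      (by simp)).clm_apply (h2.contDiffAt.differentiableAt (by simp))
  refine h3.congr_of_eventuallyEq ?_
  filter_upwards [(isOpen_mapDomain hι.continuous).mem_nhds hx] with y hy
  exact (fderiv_mapIn_field (mdifferentiable_of_mem_maximalAtlas (by simp) he)
    (mdifferentiable_of_mem_maximalAtlas (by simp) hh) (hι.mdifferentiable (by simp)) hy).symm

lemma mfderiv_components_push (hh : h.MDifferentiable (𝓡 m) (𝓡 m)) (hx : x ∈ h.target)
    (hN : DifferentiableAt ℝ (fieldIn e ι n h) x) (X : EuclideanSpace ℝ (Fin m)) :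
    (mfderiv (𝓡 m) (𝓡 (m + 1)) (fun q => components e (push ι q (n q))) (h.symm x)
      (chartSymmDeriv h x X) : EuclideanSpace ℝ (Fin (m + 1))) =
      fderiv ℝ (fieldIn e ι n h) x X := by
  have hq := h.map_target hx
  have h1 : HasMFDerivAt (𝓡 m) (𝓡 (m + 1)) (fieldIn e ι n h) (h (h.symm x))
      (fderiv ℝ (fieldIn e ι n h) x) := by
    rw [h.right_inv hx]
    exact hasMFDerivAt_iff_hasFDerivAt.2 hN.hasFDerivAt
  have h2 := h1.comp (h.symm x) (hh.mdifferentiableAt hq).hasMFDerivAt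
  have h3 := h2.congr_of_eventuallyEq (f₁ := fun q => components e (push ι q (n q))) (by
    filter_upwards [h.open_source.mem_nhds hq] with q hq
    exact congrArg (fun q => components e (push ι q (n q))) (h.left_inv hq).symm)
  rw [h3.mfderiv]
  exact congrArg (fderiv ℝ (fieldIn e ι n h) x) (chartDeriv_chartSymmDeriv hh hx X)

end

/-! ### Totally geodesic null hypersurfaces -/

section

variable {m : ℕ} {M : Type*} [TopologicalSpace M]
  [ChartedSpace (EuclideanSpace ℝ (Fin (m + 1))) M]
  [IsManifold (𝓡 (m + 1)) ∞ M] {F : FinslerSpacetime m M}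
  {e : OpenPartialHomeomorph M (EuclideanSpace ℝ (Fin (m + 1)))}
  {H : Type*} [TopologicalSpace H] [ChartedSpace (EuclideanSpace ℝ (Fin m)) H]
  {ι : H → M} {n : ∀ p : H, TangentSpace (𝓡 m) p}
  {η : ∀ p : H, TangentSpace (𝓡 m) p →L[ℝ] ℝ}
  {h : OpenPartialHomeomorph H (EuclideanSpace ℝ (Fin m))} {p : H}

lemma IsNullHypersurface.fderiv_eq_zero_iff_mem_range (hH : F.IsNullHypersurface ι n)
    (he : e ∈ IsManifold.maximalAtlas (𝓡 (m + 1)) ∞ M) (hh : h.MDifferentiable (𝓡 m) (𝓡 m))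
    (hp : p ∈ h.source) (hpe : ι p ∈ e.source) (W : EuclideanSpace ℝ (Fin (m + 1))) :
    fderiv ℝ (F.lagrangianIn e) (mapIn e ι h (h p), fieldIn e ι n h (h p)) (0, W) = 0 ↔
      W ∈ Set.range (fderiv ℝ (mapIn e ι h) (h p)) := by
  have hd := mdifferentiable_of_mem_maximalAtlas (by simp) he
  have hι := hH.contMDiff.mdifferentiable (by simp)
  rw [coords_push_eq hp, hH.fderiv_eq_zero_iff he hpe]
  constructor
  · rintro ⟨X, rfl⟩
    exact ⟨_, fderiv_mapIn_chartDeriv hd hh hι hp hpe X⟩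
  · rintro ⟨X, rfl⟩
    refine ⟨chartSymmDeriv h (h p) X, ?_⟩
    rw [← fderiv_mapIn_chartDeriv hd hh hι hp hpe]
    have := chartDeriv_chartSymmDeriv hh (h.map_source hp) X
    rw [h.left_inv hp] at this
    rw [this]

variable [IsManifold (𝓡 m) 1 H]

/-- Transfers the geodesic condition to an open set of the model space, in the form required by
`curvature_eq_smul`. -/
lemma IsTotallyGeodesic.fderiv_fieldIn (hT : F.IsTotallyGeodesic ι n η)
    (he : e ∈ IsManifold.maximalAtlas (𝓡 (m + 1)) ∞ M)
    (hh : h ∈ IsManifold.maximalAtlas (𝓡 m) 2 H) {x : EuclideanSpace ℝ (Fin m)}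
    (hx : x ∈ mapDomain e ι h) (X : EuclideanSpace ℝ (Fin m)) :
    fderiv ℝ (fieldIn e ι n h) x X +
      LocalFinsler.nonlinConn (F.lagrangianIn e) (mapIn e ι h x, fieldIn e ι n h x)
        (fderiv ℝ (mapIn e ι h) x X) = oneFormIn h η x X • fieldIn e ι n h x := by
  have he2 : e ∈ IsManifold.maximalAtlas (𝓡 (m + 1)) 2 M :=
    IsManifold.maximalAtlas_subset_of_le ENat.LEInfty.out he
  have hdh := mdifferentiable_of_mem_maximalAtlas (by simp) hh
  have h1 := hT.covDeriv_eq e he (h.symm x) hx.2 (chartSymmDeriv h x X)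
  rw [← mfderiv_components_push hdh hx.1
      (differentiableAt_fieldIn he2 hh hT.contMDiff hT.contMDiff_field hx),
    fderiv_mapIn (mdifferentiable_of_mem_maximalAtlas (by simp) he) hdh
      (hT.contMDiff.mdifferentiable (by simp)) hx]
  exact h1

/-- The Ricci scalar vanishes on a totally geodesic null hypersurface. -/
lemma IsNullHypersurface.ricciScalarVanishes (hH : F.IsNullHypersurface ι n)
    (hT : F.IsTotallyGeodesic ι n η) : F.RicciScalarVanishes ι n := by
  intro e he p hpe
  have := hT.isManifold
  let h := chartAt (EuclideanSpace ℝ (Fin m)) p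
  have hh : h ∈ IsManifold.maximalAtlas (𝓡 m) 2 H := IsManifold.chart_mem_maximalAtlas p
  have hp : p ∈ h.source := mem_chart_source _ p
  have he2 : e ∈ IsManifold.maximalAtlas (𝓡 (m + 1)) 2 M :=
    IsManifold.maximalAtlas_subset_of_le ENat.LEInfty.out he
  have hd := mdifferentiable_of_mem_maximalAtlas (by simp) he
  have hdh := mdifferentiable_of_mem_maximalAtlas (by simp) hh
  have hx := mem_mapDomain hp hpe
  have hev := (isOpen_mapDomain hT.contMDiff.continuous).mem_nhds hx
  have hz := coords_mem_slitDomain hd (v := push ι p (n p)) hpe (hH.lightlike p).1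
  rw [← coords_push_eq hp] at hz ⊢
  exact (F.isLagrangianOn_lagrangianIn he).ricciScalar_eq_zero hz
    (contDiffAt_mapIn he2 hh hT.contMDiff hx)
    (by filter_upwards [hev] with x hx using
      differentiableAt_fieldIn he2 hh hT.contMDiff hT.contMDiff_field hx)
    (by filter_upwards [hev] with x hx using hT.fderiv_fieldIn he hh hx)
    (fderiv_mapIn_field hd hdh (hT.contMDiff.mdifferentiable (by simp)) hx) hz.2
    (hH.fderiv_eq_zero_iff_mem_range he hdh hp hpe)

/-- The Ricci 1-form of a totally geodesic null hypersurface. -/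
lemma IsNullHypersurface.ricciForm_eq_extDerivIn (hH : F.IsNullHypersurface ι n)
    (hT : F.IsTotallyGeodesic ι n η) (hη : IsC1OneForm η)
    (he : e ∈ IsManifold.maximalAtlas (𝓡 (m + 1)) ∞ M)
    (hh : h ∈ IsManifold.maximalAtlas (𝓡 m) 2 H) (hp : p ∈ h.source) (hpe : ι p ∈ e.source)
    (Y : TangentSpace (𝓡 m) p) :
    LocalFinsler.ricciForm (F.lagrangianIn e) (coords e (push ι p (n p)))
      (components e (push ι p Y)) = extDerivIn h η p (n p) Y := by
  have he2 : e ∈ IsManifold.maximalAtlas (𝓡 (m + 1)) 2 M :=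
    IsManifold.maximalAtlas_subset_of_le ENat.LEInfty.out he
  have hd := mdifferentiable_of_mem_maximalAtlas (by simp) he
  have hdh := mdifferentiable_of_mem_maximalAtlas (by simp) hh
  have hι := hT.contMDiff.mdifferentiable (by simp)
  have hx := mem_mapDomain hp hpe
  have hev := (isOpen_mapDomain hT.contMDiff.continuous).mem_nhds hx
  have hz := coords_mem_slitDomain hd (v := push ι p (n p)) hpe (hH.lightlike p).1
  have hn : fderiv ℝ (mapIn e ι h) (h p) (chartDeriv h p (n p)) = fieldIn e ι n h (h p) :=
    (fderiv_mapIn_chartDeriv hd hdh hι hp hpe (n p)).trans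
      (congrArg (fun q => components e (push ι q (n q))) (h.left_inv hp).symm)
  rw [← coords_push_eq hp] at hz ⊢
  have key := (F.isLagrangianOn_lagrangianIn he).ricciForm_eq_extDeriv hz
    (contDiffAt_mapIn he2 hh hT.contMDiff hx)
    (by filter_upwards [hev] with x hx using
      differentiableAt_fieldIn he2 hh hT.contMDiff hT.contMDiff_field hx)
    (((hη h hh).contDiffAt (h.open_target.mem_nhds (h.map_source hp))).differentiableAt (by simp))
    (by filter_upwards [hev] with x hx using hT.fderiv_fieldIn he hh hx)
    hn hz.2 (hH.fderiv_eq_zero_iff_mem_range he hdh hp hpe) (chartDeriv h p Y)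
  exact (congrArg (LocalFinsler.ricciForm (F.lagrangianIn e) _)
    (fderiv_mapIn_chartDeriv hd hdh hι hp hpe Y)).symm.trans key

lemma IsNullHypersurface.ricciFormVanishes_iff (hH : F.IsNullHypersurface ι n)
    (hT : F.IsTotallyGeodesic ι n η) (hη : IsC1OneForm η) :
    F.RicciFormVanishes ι n ↔ InteriorExtDerivVanishes n η := by
  have := hT.isManifold
  constructor
  · intro hR h hh p hp Y
    have hpe := mem_chart_source (EuclideanSpace ℝ (Fin (m + 1))) (ι p)
    have he : chartAt (EuclideanSpace ℝ (Fin (m + 1))) (ι p) ∈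
        IsManifold.maximalAtlas (𝓡 (m + 1)) ∞ M := IsManifold.chart_mem_maximalAtlas _
    rw [← hH.ricciForm_eq_extDerivIn hT hη he hh hp hpe]
    exact hR _ he p hpe Y
  · intro hI e he p hpe Y
    have hh : chartAt (EuclideanSpace ℝ (Fin m)) p ∈ IsManifold.maximalAtlas (𝓡 m) 2 H :=
      IsManifold.chart_mem_maximalAtlas p
    rw [hH.ricciForm_eq_extDerivIn hT hη he hh (mem_chart_source _ p) hpe]
    exact hI _ hh p (mem_chart_source _ p) Y

end

end FinslerSpacetime

end

theorem mainTheorem2 {m : ℕ} {M : Type*} [TopologicalSpace M] [T2Space M] [ParacompactSpace M]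
    [ConnectedSpace M] [ChartedSpace (EuclideanSpace ℝ (Fin (m + 1))) M]
    [IsManifold (𝓡 (m + 1)) ∞ M] (F : FinslerSpacetime m M)
    {H : Type*} [TopologicalSpace H] [ChartedSpace (EuclideanSpace ℝ (Fin m)) H]
    [IsManifold (𝓡 m) 1 H] (ι : H → M) (n : ∀ p : H, TangentSpace (𝓡 m) p)
    (hH : F.IsNullHypersurface ι n) :
    -- the two forms of the gravitational equation are equivalent
    (F.RicciGradientEq ↔ F.ChiVanishes) ∧
    -- the main implication
    (F.NullConvergence → F.RicciGradientEq → F.RicciScalarVanishes ι n →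
      F.RicciFormVanishes ι n) ∧
    -- the totally geodesic case
    (∀ η : ∀ p : H, TangentSpace (𝓡 m) p →L[ℝ] ℝ, F.IsTotallyGeodesic ι n η →
      F.RicciScalarVanishes ι n ∧
      (IsC1OneForm η →
        (F.RicciFormVanishes ι n ↔ InteriorExtDerivVanishes n η) ∧
        (F.NullConvergence → F.RicciGradientEq → InteriorExtDerivVanishes n η))) := by
  refine ⟨F.ricciGradientEq_iff_chiVanishes, hH.ricciFormVanishes, fun η hT => ?_⟩
  have hR := hH.ricciScalarVanishes hT
  refine ⟨hR, fun hη => ⟨hH.ricciFormVanishes_iff hT hη, fun hnc hgrad => ?_⟩⟩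
  exact (hH.ricciFormVanishes_iff hT hη).1 (hH.ricciFormVanishes hnc hgrad hR)
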